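/- **Setting.** Let $d\ge 1$ and let $f$ be an admissible probability density on $\mathbb R^d$, i.e. $f$ is a measurable probability density whose support $S$ is the disjoint union of $K$ path-connected compact sets $S_1,\dots,S_K$; for each $k$ the diameter of $S_k$ with respect to lengths of paths inside $S_k$ is at most $\ell<\infty$; there is $\theta>0$ with $f\ge\theta$ on $S$; and there are $r_0,p>0$ with $\mathrm{vol}(B(x,r)\cap S_k)\ge p r^d$ for all $k$, $x\in S_k$, $r\in(0,r_0]$. Let $a_1,\dots,a_n$ be i.i.d. with density $f$ and $C_k=\{i: a_i\in S_k\}$. The leapfrog distance $\mathrm{LF}(a_i,a_j)$ is the cost of a shortest path from $i$ to $j$ in the complete graph on $\{1,\dots,n\}$ with edge costs $\|a_s-a_t\|^2$. For a symmetric matrix $A$ of squared distances and a base index $o$, put $G_o(A)_{ij}=A_{ij}-A_{oi}-A_{oj}$. Let $D_{ij}=\mathrm{LF}(a_i,a_j)^2$, and let $G_1(D)=Q\Lambda Q^T$ be any orthogonal eigendecomposition with $|\lambda_1|\ge|\lambda_2|\ge\dots\ge|\lambda_n|$. The $L$-dimensional re-embeddings are $b_i=(\sqrt{|\lambda_l|}\,Q_{il})_{l=1,\dots,L}\in\mathbb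 R^L$ (coordinates with $l>n$ are $0$). **Constants.** Let $\Delta_{km}$ be the cost of a shortest path from $k$ to $m$ in the complete graph on $\{1,\dots,K\}$ with edge costs $\mathrm{dist}(S_s,S_t)^2$ (the large-sample limit of the leapfrog distance between points of $S_k$ and $S_m$), and $A^\ast_{km}=\Delta_{km}^2$. Let $F=\mathrm{Diag}(\sqrt{p_1},\dots,\sqrt{p_K})$ with $p_k=\int_{S_k}f$. For a symmetric $K\times K$ matrix $A$ and a base cluster $o$ let $\sigma_o(A)$ be half the smallest magnitude of a nonzero eigenvalue of $F\,G_o(A)\,F$. Let $L=\mathrm{rank}\,G_o(A^\ast)$, $\sigma=\sigma_o(A^\ast)$ and $c_g=72\,\mathrm{diam}(S)^2\,\ell$, where the base cluster $o$ is the cluster of $a_1$. (If $K=1$, then $L=0$, no $\sigma$ is needed, and the bounds below are read as $0$.) **Theorem.** Let $0<\eta<1/d$ and $\gamma=1/d-\eta$. There are constants $c_1,c_2,c_3>0$, not depending on $n$, such that for every $n\ge1$, with probability at least $1-c_1\exp(-c_2n^{c_3})$, the following holds for every such eigendecomposition, for all $k$ and all $i,i'\in C_k$: $$\|b_i-b_{i'}\|_2\le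 \frac{6c_g\sqrt L}{\sqrt\sigma}\,n^{-\gamma},$$ and the same bound also holds with $\sigma$ replaced by $\sigma_o(A_0)$, where $A_0=(\mathrm{LF}(\mu_k,\mu_m)^2)_{k,m}$, for every choice of one data point $\mu_k\in S_k$ from each cluster. Moreover, for each of the finitely many possible base clusters $o$, $\frac{6c_g\sqrt L}{\sqrt\sigma}\,n^{-\gamma}\to0$ as $n\to\infty$. -/

import Mathlib

open MeasureTheory

noncomputable section

namespace Leapfrog

/-- Total cost of the walk `i → k₁ → … → k_r → j`, where `[k₁, …, k_r]` is the list of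
intermediate vertices and `c` gives the edge costs. -/
def walkCost {ι : Type*} (c : ι → ι → ℝ) (i j : ι) : List ι → ℝ
  | [] => c i j
  | k :: l => c i k + walkCost c k j l

/-- Cost of a shortest path from `i` to `j` in the complete graph with edge costs `c`. -/
def shortestPath {ι : Type*} (c : ι → ι → ℝ) (i j : ι) : ℝ :=
  ⨅ l : List ι, walkCost c i j l

/-- The leapfrog distance between the `i`-th and the `j`-th data point: the shortest-path cost
in the complete graph whose edge costs are the squared Euclidean distances. -/
def LF {d n : ℕ} (a : Fin n → EuclideanSpace ℝ (Fin d)) (i j : Fin n) : ℝ :=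
  shortestPath (fun s t => dist (a s) (a t) ^ 2) i j

/-- The matrix `D` of squared leapfrog distances. -/
def sqLF {d n : ℕ} (a : Fin n → EuclideanSpace ℝ (Fin d)) : Matrix (Fin n) (Fin n) ℝ :=
  Matrix.of fun i j => LF a i j ^ 2

/-- The Gram matrix `G(A)` of a symmetric matrix `A` of squared distances, with base point `o`:
the column and the row of the base point are subtracted from all columns and rows. -/
def gram {ι : Type*} (o : ι) (A : Matrix ι ι ℝ) : Matrix ι ι ℝ :=
  Matrix.of fun i j => A i j - A o i - A o j

/-- `M = Q Diag(ev) Qᵀ` is an orthogonal eigendecomposition of `M` in which the eigenvalues are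
listed by decreasing magnitude. -/
def IsEigendecomposition {n : ℕ} (M Q : Matrix (Fin n) (Fin n) ℝ) (ev : Fin n → ℝ) : Prop :=
  Q ∈ Matrix.orthogonalGroup (Fin n) ℝ ∧ M = Q * Matrix.diagonal ev * Q.transpose ∧
    Antitone fun l => |ev l|

/-- The `L`-dimensional re-embedding `b i`, the `i`-th column of
`Diag(√|ev 1|, …, √|ev L|) Q_Lᵀ` (padded with zeros in the irrelevant case `n < L`). -/
def embed {n : ℕ} (Q : Matrix (Fin n) (Fin n) ℝ) (ev : Fin n → ℝ) (L : ℕ) (i : Fin n) :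
    EuclideanSpace ℝ (Fin L) :=
  WithLp.toLp 2 fun l =>
    if h : (l : ℕ) < n then Real.sqrt |ev ⟨l, h⟩| * Q i ⟨l, h⟩ else 0

/-- Infimum of the lengths of the paths from `x` to `y` that stay inside `T`. -/
def pathDist {d : ℕ} (T : Set (EuclideanSpace ℝ (Fin d))) (x y : EuclideanSpace ℝ (Fin d)) :
    ENNReal :=
  ⨅ (g : Path x y) (_ : ∀ t, g t ∈ T), eVariationOn (fun t : unitInterval => g t) Set.univ

/-- `f` is an admissible probability density on `ℝᵈ`; its support is the disjoint union of the
path-connected compact sets `S 1, …, S K`, each of diameter at most `ell` with respect to paths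
inside it. (As `f` is bounded below by a positive number on its support and the support is
compact, `{x | f x ≠ 0}` and its closure are the same set.) -/
structure IsAdmissible {d K : ℕ} (f : EuclideanSpace ℝ (Fin d) → ℝ)
    (S : Fin K → Set (EuclideanSpace ℝ (Fin d))) (ell : ℝ) : Prop where
  measurable : Measurable f
  nonneg : ∀ x, 0 ≤ f x
  lintegral_eq_one : ∫⁻ x, ENNReal.ofReal (f x) = 1
  support_eq : Function.support f = ⋃ k, S k
  isCompact : ∀ k, IsCompact (S k)
  isPathConnected : ∀ k, IsPathConnected (S k)
  disjoint : Pairwise fun k m => Disjoint (S k) (S m)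
  pathDist_le : ∀ k, ∀ x ∈ S k, ∀ y ∈ S k, pathDist (S k) x y ≤ ENNReal.ofReal ell
  bounded_below : ∃ θ : ℝ, 0 < θ ∧ ∀ x ∈ Function.support f, θ ≤ f x
  no_cusp : ∃ r₀ p : ℝ, 0 < r₀ ∧ 0 < p ∧ ∀ k, ∀ x ∈ S k, ∀ r : ℝ, 0 < r → r ≤ r₀ →
    ENNReal.ofReal (p * r ^ d) ≤ volume (Metric.closedBall x r ∩ S k)

/-- The probability measure on `ℝᵈ` with density `f`. -/
def law {d : ℕ} (f : EuclideanSpace ℝ (Fin d) → ℝ) : Measure (EuclideanSpace ℝ (Fin d)) :=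
  volume.withDensity fun x => ENNReal.ofReal (f x)

/-- The law of `n` independent samples from the density `f`. -/
def sampleLaw {d : ℕ} (f : EuclideanSpace ℝ (Fin d) → ℝ) (n : ℕ) :
    Measure (Fin n → EuclideanSpace ℝ (Fin d)) :=
  Measure.pi fun _ => law f

/-- Euclidean distance between two sets. -/
def setDist {d : ℕ} (T T' : Set (EuclideanSpace ℝ (Fin d))) : ℝ :=
  ⨅ q : T × T', dist (q.1 : EuclideanSpace ℝ (Fin d)) (q.2 : EuclideanSpace ℝ (Fin d))

/-- The limiting matrix of squared leapfrog distances between clusters: inside a cluster the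
leapfrog distance vanishes in the limit, so that the limit of the leapfrog distance between two
clusters is the shortest-path cost in the complete graph on the clusters, with the squared
distances between the clusters as edge costs. -/
def limitSqLF {d K : ℕ} (S : Fin K → Set (EuclideanSpace ℝ (Fin d))) :
    Matrix (Fin K) (Fin K) ℝ :=
  Matrix.of fun k m => shortestPath (fun s t => setDist (S s) (S t) ^ 2) k m ^ 2

/-- The matrix of squared leapfrog distances between the representatives `a (rep k)`. -/
def repSqLF {d n K : ℕ} (a : Fin n → EuclideanSpace ℝ (Fin d)) (rep : Fin K → Fin n) :
    Matrix (Fin K) (Fin K) ℝ :=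
  Matrix.of fun k m => LF a (rep k) (rep m) ^ 2

/-- The diagonal matrix `F` with entries `√(p k)`, where `p k` is the mass of `S k`. -/
def sqrtMass {d K : ℕ} (f : EuclideanSpace ℝ (Fin d) → ℝ)
    (S : Fin K → Set (EuclideanSpace ℝ (Fin d))) : Matrix (Fin K) (Fin K) ℝ :=
  Matrix.diagonal fun k => Real.sqrt ((law f).real (S k))

/-- Half the smallest magnitude of a nonzero eigenvalue of `F G(A) F`, where the Gram matrix is
formed with base cluster `o`. -/
def sigma {d K : ℕ} (f : EuclideanSpace ℝ (Fin d) → ℝ)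
    (S : Fin K → Set (EuclideanSpace ℝ (Fin d))) (o : Fin K) (A : Matrix (Fin K) (Fin K) ℝ) : ℝ :=
  sInf {r : ℝ | ∃ z : ℝ, z ≠ 0 ∧ r = |z| ∧
    Module.End.HasEigenvalue (Matrix.toLin' (sqrtMass f S * gram o A * sqrtMass f S)) z} / 2

/-- The embedding dimension: the rank of the Gram matrix of the limiting cluster distances. -/
def embDim {d K : ℕ} (S : Fin K → Set (EuclideanSpace ℝ (Fin d))) (o : Fin K) : ℕ :=
  (gram o (limitSqLF S)).rank

/-- The constant `c_g = 72 diam(S)² ell`, where `S` is the union of the sets `S k`. -/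
def cg {d K : ℕ} (S : Fin K → Set (EuclideanSpace ℝ (Fin d))) (ell : ℝ) : ℝ :=
  72 * Metric.diam (⋃ k, S k) ^ 2 * ell

/-- The bound `6 c_g √L / √σ · n ^ (-γ)` with `γ = 1 / d - η`. -/
def bound {d K : ℕ} (S : Fin K → Set (EuclideanSpace ℝ (Fin d))) (ell η : ℝ) (L : ℕ) (σ : ℝ)
    (n : ℕ) : ℝ :=
  6 * cg S ell * Real.sqrt L / Real.sqrt σ * (n : ℝ) ^ (-(1 / (d : ℝ) - η))

end Leapfrog

end

noncomputable section

namespace Leapfrog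

/-! Call a sample good if every point of every `S k` has a data point of `S k` within `ε = n ^ (-γ)
/ 4`, and the cluster frequencies are close to the masses `p k`. On good samples the bound is
deterministic.

Numerator: inside a cluster one can leap along a path of length about `ell` in order `ell / ε` leaps
of length `O(ε)`, each costing `O(ε²)`, so `LF ≤ 36 * ell * ε` (`LF_le_of_pathDist_le`). By the
triangle inequality, two rows of the Gram matrix `G` belonging to one cluster differ by at most `2 *
c_g * ε` in each entry, hence by `√n * 2 * c_g * ε` in norm. As `G Q = Q Λ`, this norm is that of
the difference of the rows of `Q Λ`, and dividing by the square root of a lower bound for the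
leading `|λ_l|` bounds the difference of the embedded points (`norm_embed_sub_le`).

Denominator: `G` is entrywise close to the block matrix with entries `B (κ i) (κ j)`, where `B =
G_o(A*)` and `κ` assigns clusters. This block matrix acts on cluster-constant vectors as `n` times
`F_n B F_n`, with `F_n` built from the frequencies, and `F_n B F_n` is close to `F B F`. A min-max
argument on the range of `F B F`, of dimension `L`, gives `|λ_l| > n * σ` for the first `L`
eigenvalues (`lt_abs_of_near_block`). The factors `√n` cancel. Only fixed precision is needed here;
the rate comes from the numerator alone.

Probability: a union bound over a net of polynomial size handles density, and Hoeffding's inequality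
handles the frequencies. -/

theorem exists_pos_forall_le {ι : Type*} [Finite ι] {f : ι → ℝ} (hf : ∀ i, 0 < f i) :
    ∃ e > 0, ∀ i, e ≤ f i := by
  rcases isEmpty_or_nonempty ι with _ | _
  · exact ⟨1, one_pos, fun i => isEmptyElim i⟩
  · obtain ⟨i, hi⟩ := Finite.exists_min f
    exact ⟨f i, hf i, hi⟩

/-! ### Shortest-path costs -/

section ShortestPath

variable {ι : Type*} {c : ι → ι → ℝ}

theorem walkCost_nonneg (hc : ∀ i j, 0 ≤ c i j) (i j : ι) (l : List ι) : 0 ≤ walkCost c i j l := by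
  induction l generalizing i with
  | nil => exact hc i j
  | cons k l ih => exact add_nonneg (hc i k) (ih k)

theorem walkCost_append_cons (i j k : ι) (l l' : List ι) :
    walkCost c i j (l ++ k :: l') = walkCost c i k l + walkCost c k j l' := by
  induction l generalizing i with
  | nil => rfl
  | cons m l ih => simp [walkCost, ih, add_assoc]

theorem walkCost_reverse (hc : ∀ i j, c i j = c j i) (i j : ι) (l : List ι) :
    walkCost c j i l.reverse = walkCost c i j l := by
  induction l generalizing i with
  | nil => exact hc j i
  | cons m l ih => simp [walkCost, walkCost_append_cons, ih, hc m i, add_comm]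

theorem walkCost_map_le {κ : Type*} {c' : κ → κ → ℝ} (p : ι → κ)
    (h : ∀ i j, c' (p i) (p j) ≤ c i j) (i j : ι) (l : List ι) :
    walkCost c' (p i) (p j) (l.map p) ≤ walkCost c i j l := by
  induction l generalizing i with
  | nil => exact h i j
  | cons m l ih => exact add_le_add (h i m) (ih m)

theorem shortestPath_le_walkCost (hc : ∀ i j, 0 ≤ c i j) (i j : ι) (l : List ι) :
    shortestPath c i j ≤ walkCost c i j l :=
  ciInf_le ⟨0, by rintro _ ⟨l, rfl⟩; exact walkCost_nonneg hc i j l⟩ l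

theorem shortestPath_le_cost (hc : ∀ i j, 0 ≤ c i j) (i j : ι) : shortestPath c i j ≤ c i j :=
  shortestPath_le_walkCost hc i j []

theorem shortestPath_nonneg (hc : ∀ i j, 0 ≤ c i j) (i j : ι) : 0 ≤ shortestPath c i j :=
  le_ciInf fun l => walkCost_nonneg hc i j l

theorem shortestPath_comm (hc : ∀ i j, c i j = c j i) (i j : ι) :
    shortestPath c i j = shortestPath c j i := by
  refine (List.reverse_involutive.toPerm _).iInf_congr fun l => ?_
  exact walkCost_reverse hc i j l

theorem shortestPath_triangle (hc : ∀ i j, 0 ≤ c i j) (i j k : ι) :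
    shortestPath c i k ≤ shortestPath c i j + shortestPath c j k := by
  refine le_ciInf_add_ciInf fun l l' => ?_
  rw [← walkCost_append_cons]
  exact shortestPath_le_walkCost hc i k _

theorem shortestPath_map_le {κ : Type*} {c' : κ → κ → ℝ} (hc' : ∀ i j, 0 ≤ c' i j) (p : ι → κ)
    (h : ∀ i j, c' (p i) (p j) ≤ c i j) (i j : ι) :
    shortestPath c' (p i) (p j) ≤ shortestPath c i j :=
  le_ciInf fun l => (shortestPath_le_walkCost hc' _ _ _).trans (walkCost_map_le p h i j l)

end ShortestPath

section LF

variable {d n : ℕ} (a : Fin n → EuclideanSpace ℝ (Fin d))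

theorem LF_nonneg (i j : Fin n) : 0 ≤ LF a i j := shortestPath_nonneg (fun _ _ => sq_nonneg _) i j

theorem LF_le_sq (i j : Fin n) : LF a i j ≤ dist (a i) (a j) ^ 2 :=
  shortestPath_le_cost (c := fun s t => dist (a s) (a t) ^ 2) (fun _ _ => sq_nonneg _) i j

theorem LF_comm (i j : Fin n) : LF a i j = LF a j i :=
  shortestPath_comm (fun i j => by rw [dist_comm]) i j

theorem LF_triangle (i j k : Fin n) : LF a i k ≤ LF a i j + LF a j k :=
  shortestPath_triangle (fun _ _ => sq_nonneg _) i j k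

theorem LF_eq_zero_of_eq {i j : Fin n} (h : a i = a j) : LF a i j = 0 :=
  le_antisymm (by simpa [h] using LF_le_sq a i j) (LF_nonneg a i j)

end LF

/-- Every point of a set `S k` is within distance `ε` of a data point in `S k`. -/
def IsDenseSample {d n K : ℕ} (S : Fin K → Set (EuclideanSpace ℝ (Fin d)))
    (a : Fin n → EuclideanSpace ℝ (Fin d)) (ε : ℝ) : Prop :=
  ∀ k, ∀ x ∈ S k, ∃ i, a i ∈ S k ∧ dist (a i) x ≤ ε

/-- The limiting leapfrog distance between clusters. -/
def limitLF {d K : ℕ} (S : Fin K → Set (EuclideanSpace ℝ (Fin d))) (k m : Fin K) : ℝ :=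
  shortestPath (fun s t => setDist (S s) (S t) ^ 2) k m

/-! ### Leapfrog distances of a dense sample and their limits -/

section Sample

variable {d n K : ℕ} {S : Fin K → Set (EuclideanSpace ℝ (Fin d))}
  {a : Fin n → EuclideanSpace ℝ (Fin d)} {ε : ℝ}

/-- An amortised cost argument: `r` is the length travelled since the last leap and not yet charged.
A leap is made only when this length would exceed `ε`; it has length at most `4 * ε`, and its cost
`16 * ε ^ 2` is paid by the accumulated length. -/
theorem exists_leapfrog_along_chain (hε : 0 ≤ ε) (i : Fin n) (x : ℕ → EuclideanSpace ℝ (Fin d))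
    (hx0 : x 0 = a i) (m : ℕ) (hnear : ∀ j ≤ m, ∃ q, dist (a q) (x j) ≤ ε)
    (hstep : ∀ j < m, dist (x j) (x (j + 1)) ≤ ε) :
    ∃ (q : Fin n) (r : ℝ), 0 ≤ r ∧ r ≤ ε ∧ dist (a q) (x m) ≤ ε + r ∧
      LF a i q ≤ 16 * ε * (∑ j ∈ Finset.range m, dist (x j) (x (j + 1)) - r) := by
  induction m with
  | zero => exact ⟨i, 0, le_rfl, hε, by simpa [hx0] using hε, by simp [LF_eq_zero_of_eq a rfl]⟩
  | succ m ih =>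
    obtain ⟨q, r, hr0, hr, hq, hLF⟩ :=
      ih (fun j hj => hnear j (by omega)) (fun j hj => hstep j (by omega))
    have hs := hstep m (by omega)
    have h1 : dist (a q) (x (m + 1)) ≤ ε + (r + dist (x m) (x (m + 1))) := by
      linarith [dist_triangle (a q) (x m) (x (m + 1))]
    rw [Finset.sum_range_succ]
    set e := dist (x m) (x (m + 1))
    have he : 0 ≤ e := dist_nonneg
    by_cases h : r + e ≤ ε
    · exact ⟨q, r + e, by positivity, h, h1, hLF.trans_eq (by ring)⟩
    · push Not at h
      obtain ⟨q', hq'⟩ := hnear (m + 1) le_rfl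
      refine ⟨q', 0, le_rfl, hε, by simpa using hq', ?_⟩
      have h2 : dist (a q) (a q') ≤ 4 * ε := by
        linarith [dist_triangle_right (a q) (a q') (x (m + 1))]
      have h3 : dist (a q) (a q') ^ 2 ≤ (4 * ε) ^ 2 := pow_le_pow_left₀ dist_nonneg h2 2
      have h4 : ε * ε ≤ ε * (r + e) := mul_le_mul_of_nonneg_left h.le hε
      linarith [LF_triangle a i q q', LF_le_sq a q q']

/-- Sampling the path at equally spaced times, fine enough by uniform continuity, gives a chain of
length at most `V`. The term `4 * ε ^ 2` pays for a last leap of length at most `2 * ε` to the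
endpoint. -/
theorem LF_le_of_path (hε : 0 < ε) {T : Set (EuclideanSpace ℝ (Fin d))}
    (hT : ∀ x ∈ T, ∃ q, dist (a q) x ≤ ε) {i i' : Fin n} (g : Path (a i) (a i'))
    (hg : ∀ t, g t ∈ T) {V : ℝ} (hV0 : 0 ≤ V)
    (hV : eVariationOn (fun t : unitInterval => g t) Set.univ ≤ ENNReal.ofReal V) :
    LF a i i' ≤ 16 * ε * V + 4 * ε ^ 2 := by
  have huc : UniformContinuous g := CompactSpace.uniformContinuous_of_continuous g.continuous
  obtain ⟨δ, hδ, hgδ⟩ := Metric.uniformContinuous_iff.1 huc ε hε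
  obtain ⟨m, hm⟩ := exists_nat_one_div_lt hδ
  let u : ℕ → unitInterval := fun j => Set.projIcc 0 1 zero_le_one ((j : ℝ) / (m + 1))
  have hm0 : (0 : ℝ) < m + 1 := by positivity
  have hu : Monotone u := fun j j' h => Set.monotone_projIcc _ (by gcongr)
  have hu0 : u 0 = 0 := by simp [u, Set.projIcc_left]
  have hu1 : u (m + 1) = 1 := by
    have : (((m + 1 : ℕ) : ℝ) / (m + 1)) = 1 := by push_cast; field_simp
    simp only [u, this, Set.projIcc_right]; rfl
  have hstep : ∀ j < m + 1, dist (g (u j)) (g (u (j + 1))) ≤ ε := fun j hj => by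
    refine (hgδ (lt_of_le_of_lt ?_ hm)).le
    have h := (LipschitzWith.projIcc (zero_le_one (α := ℝ))).dist_le_mul
      ((j : ℝ) / (m + 1)) (((j + 1 : ℕ) : ℝ) / (m + 1))
    refine h.trans (le_of_eq ?_)
    rw [Real.dist_eq, abs_sub_comm, ← sub_div]
    push_cast
    simp [abs_of_pos hm0]
  obtain ⟨q, r, hr0, hr, hq, hLF⟩ := exists_leapfrog_along_chain hε.le i (fun j => g (u j))
    (by simp [hu0]) (m + 1) (fun j _ => hT _ (hg _)) hstep
  have hsum : ∑ j ∈ Finset.range (m + 1), dist (g (u j)) (g (u (j + 1))) ≤ V := by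
    rw [← ENNReal.ofReal_le_ofReal_iff hV0, ENNReal.ofReal_sum_of_nonneg fun _ _ => dist_nonneg]
    refine le_trans (le_of_eq ?_) ((eVariationOn.sum_le (f := fun t : unitInterval => g t)
      (n := m + 1) (u := u) (s := Set.univ) hu (fun _ => Set.mem_univ _)).trans hV)
    refine Finset.sum_congr rfl fun j _ => ?_
    rw [← edist_dist, edist_comm]
  rw [hu1, g.target] at hq
  have h2 : dist (a q) (a i') ^ 2 ≤ (2 * ε) ^ 2 := pow_le_pow_left₀ dist_nonneg (by linarith) 2
  have h3 : 16 * ε * (∑ j ∈ Finset.range (m + 1), dist (g (u j)) (g (u (j + 1))) - r)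
      ≤ 16 * ε * V := by
    apply mul_le_mul_of_nonneg_left _ (by positivity); linarith
  linarith [LF_triangle a i q i', LF_le_sq a q i']

theorem LF_le_of_pathDist_le {ell : ℝ} (hell : 0 < ell) (hε : 0 < ε) (hεl : ε ≤ ell)
    (hS : ∀ k, ∀ x ∈ S k, ∀ y ∈ S k, pathDist (S k) x y ≤ ENNReal.ofReal ell)
    (ha : IsDenseSample S a ε) {k : Fin K} {i i' : Fin n} (hi : a i ∈ S k) (hi' : a i' ∈ S k) :
    LF a i i' ≤ 36 * ell * ε := by
  -- The infimum of path lengths need not be attained; a path shorter than `2 * ell` exists, and `16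
  -- * 2 + 4 = 36`.
  have h : pathDist (S k) (a i) (a i') < ENNReal.ofReal (2 * ell) :=
    (hS k _ hi _ hi').trans_lt ((ENNReal.ofReal_lt_ofReal_iff (by positivity)).2 (by linarith))
  simp only [pathDist, iInf_lt_iff] at h
  obtain ⟨g, hg, hV⟩ := h
  have := LF_le_of_path hε (fun x hx => (ha k x hx).imp fun _ h => h.2) g hg (by positivity) hV.le
  nlinarith

theorem setDist_nonneg (T T' : Set (EuclideanSpace ℝ (Fin d))) : 0 ≤ setDist T T' :=
  Real.iInf_nonneg fun _ => dist_nonneg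

theorem setDist_le_dist {T T' : Set (EuclideanSpace ℝ (Fin d))} {x y : EuclideanSpace ℝ (Fin d)}
    (hx : x ∈ T) (hy : y ∈ T') : setDist T T' ≤ dist x y :=
  ciInf_le (f := fun q : T × T' => dist (q.1 : EuclideanSpace ℝ (Fin d)) q.2)
    ⟨0, by rintro _ ⟨q, rfl⟩; exact dist_nonneg⟩ (⟨x, hx⟩, ⟨y, hy⟩)

theorem setDist_comm (T T' : Set (EuclideanSpace ℝ (Fin d))) : setDist T T' = setDist T' T :=
  (Equiv.prodComm T T').iInf_congr fun _ => dist_comm _ _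

theorem limitLF_comm (k m : Fin K) : limitLF S k m = limitLF S m k :=
  shortestPath_comm (fun i j => by rw [setDist_comm]) k m

theorem limitLF_nonneg (k m : Fin K) : 0 ≤ limitLF S k m :=
  shortestPath_nonneg (fun _ _ => sq_nonneg _) k m

/-- Replacing each data point by its cluster turns a walk into one between clusters that costs no
more. This half of the convergence holds for every sample. -/
theorem limitLF_le_LF {p : Fin n → Fin K} (hp : ∀ i, a i ∈ S (p i)) (i j : Fin n) :
    limitLF S (p i) (p j) ≤ LF a i j :=
  shortestPath_map_le (c' := fun s t => setDist (S s) (S t) ^ 2) (fun _ _ => sq_nonneg _) p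
    (fun i j => pow_le_pow_left₀ (setDist_nonneg _ _) (setDist_le_dist (hp i) (hp j)) 2) i j

/-- Walk inside `S k` to a data point near an almost closest pair, leap across, and walk inside `S
m`. The `3 * ε` consists of `ε` for the almost closest pair and `ε` for each of the two data points.
The threshold does not depend on `n` or on the sample. -/
theorem exists_LF_le_sq_setDist (hne : ∀ k, (S k).Nonempty) (ρ : ℝ)
    (k m : Fin K) {δ : ℝ} (hδ : 0 < δ) :
    ∃ ε₀ > 0, ∀ ε, 0 < ε → ε ≤ ε₀ → ∀ {n : ℕ} (a : Fin n → EuclideanSpace ℝ (Fin d)),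
      IsDenseSample S a ε → (∀ k i i', a i ∈ S k → a i' ∈ S k → LF a i i' ≤ ρ * ε) →
      ∀ i j, a i ∈ S k → a j ∈ S m → LF a i j ≤ setDist (S k) (S m) ^ 2 + δ := by
  have : Nonempty (S k × S m) := ⟨⟨_, (hne k).some_mem⟩, ⟨_, (hne m).some_mem⟩⟩
  have hcont : ContinuousAt (fun t : ℝ => (setDist (S k) (S m) + 3 * t) ^ 2 + 2 * (ρ * t)) 0 := by
    fun_prop
  have hev := hcont.eventually_lt_const (u := setDist (S k) (S m) ^ 2 + δ) (by simpa using hδ)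
  obtain ⟨ε₀, hε₀, h⟩ := Metric.eventually_nhds_iff.1 hev
  refine ⟨ε₀ / 2, by positivity, fun ε hε hεl n a ha hρ i j hi hj => ?_⟩
  obtain ⟨⟨⟨x, hx⟩, ⟨y, hy⟩⟩, hxy⟩ := exists_lt_of_ciInf_lt
    (show setDist (S k) (S m) < setDist (S k) (S m) + ε by linarith)
  obtain ⟨q, hqS, hq⟩ := ha k x hx
  obtain ⟨q', hqS', hq'⟩ := ha m y hy
  have h1 : dist (a q) (a q') ≤ setDist (S k) (S m) + 3 * ε := by
    have := dist_triangle4 (a q) x y (a q')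
    rw [dist_comm y] at this
    simp only at hxy
    linarith
  have h2 := pow_le_pow_left₀ dist_nonneg h1 2
  have h3 : (setDist (S k) (S m) + 3 * ε) ^ 2 + 2 * (ρ * ε) < setDist (S k) (S m) ^ 2 + δ :=
    h (by rw [Real.dist_eq, sub_zero, abs_of_pos hε]; linarith)
  linarith [LF_triangle a i q j, LF_triangle a q q' j, LF_le_sq a q q', hρ k i q hi hqS,
    hρ m q' j hqS' hj]

theorem exists_LF_le_walkCost (hne : ∀ k, (S k).Nonempty) (ρ : ℝ) (l : List (Fin K))
    (k m : Fin K) {δ : ℝ} (hδ : 0 < δ) :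
    ∃ ε₀ > 0, ∀ ε, 0 < ε → ε ≤ ε₀ → ∀ {n : ℕ} (a : Fin n → EuclideanSpace ℝ (Fin d)),
      IsDenseSample S a ε → (∀ k i i', a i ∈ S k → a i' ∈ S k → LF a i i' ≤ ρ * ε) →
      ∀ i j, a i ∈ S k → a j ∈ S m →
        LF a i j ≤ walkCost (fun s t => setDist (S s) (S t) ^ 2) k m l + δ := by
  induction l generalizing k δ with
  | nil => exact exists_LF_le_sq_setDist hne ρ k m hδ
  | cons s l ih =>
    obtain ⟨ε₁, hε₁, h₁⟩ := ih s (half_pos hδ)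
    obtain ⟨ε₂, hε₂, h₂⟩ := exists_LF_le_sq_setDist hne ρ k s (half_pos hδ)
    refine ⟨min ε₁ ε₂, by positivity, fun ε hε hεl n a ha hρ i j hi hj => ?_⟩
    obtain ⟨q, hqS, -⟩ := ha s _ (hne s).some_mem
    have h3 := h₁ ε hε (hεl.trans (min_le_left _ _)) a ha hρ q j hqS hj
    have h4 := h₂ ε hε (hεl.trans (min_le_right _ _)) a ha hρ i q hi hqS
    simp only [walkCost]
    linarith [LF_triangle a i q j]

theorem exists_LF_le_limitLF (hne : ∀ k, (S k).Nonempty) (ρ : ℝ) {δ : ℝ} (hδ : 0 < δ) :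
    ∃ ε₀ > 0, ∀ ε, 0 < ε → ε ≤ ε₀ → ∀ {n : ℕ} (a : Fin n → EuclideanSpace ℝ (Fin d)),
      IsDenseSample S a ε → (∀ k i i', a i ∈ S k → a i' ∈ S k → LF a i i' ≤ ρ * ε) →
      ∀ k m i j, a i ∈ S k → a j ∈ S m → LF a i j ≤ limitLF S k m + δ := by
  have key : ∀ q : Fin K × Fin K, ∃ ε₀ > 0, ∀ ε, 0 < ε → ε ≤ ε₀ → ∀ {n : ℕ}
      (a : Fin n → EuclideanSpace ℝ (Fin d)),
      IsDenseSample S a ε → (∀ k i i', a i ∈ S k → a i' ∈ S k → LF a i i' ≤ ρ * ε) →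
      ∀ i j, a i ∈ S q.1 → a j ∈ S q.2 → LF a i j ≤ limitLF S q.1 q.2 + δ := fun q => by
    -- One almost optimal walk is fixed, so that the threshold depends on finitely many edges only.
    obtain ⟨l, hl⟩ := exists_lt_of_ciInf_lt
      (show limitLF S q.1 q.2 < limitLF S q.1 q.2 + δ / 2 by linarith)
    obtain ⟨ε₀, hε₀, h⟩ := exists_LF_le_walkCost hne ρ l q.1 q.2 (half_pos hδ)
    exact ⟨ε₀, hε₀, fun ε hε hεl n a ha hρ i j hi hj =>
      (h ε hε hεl a ha hρ i j hi hj).trans (by linarith)⟩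
  choose ε₀ hε₀ h using key
  obtain ⟨e, he, hle⟩ := exists_pos_forall_le hε₀
  exact ⟨e, he, fun ε hε hεl n a ha hρ k m i j hi hj =>
    h (k, m) ε hε (hεl.trans (hle _)) a ha hρ i j hi hj⟩

end Sample

end Leapfrog

/-! ### Eigendecompositions and spectral embeddings -/

namespace Leapfrog

open Matrix

theorem norm_toLp_sq {ι : Type*} [Fintype ι] (v : ι → ℝ) : ‖WithLp.toLp 2 v‖ ^ 2 = v ⬝ᵥ v := by
  rw [EuclideanSpace.norm_sq_eq]; simp [dotProduct, pow_two]

theorem dotProduct_mulVec_self_of_orthogonal {ι : Type*} [Fintype ι] [DecidableEq ι]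
    {Q : Matrix ι ι ℝ} (hQ : Q ∈ orthogonalGroup ι ℝ) (v : ι → ℝ) :
    (Q *ᵥ v) ⬝ᵥ (Q *ᵥ v) = v ⬝ᵥ v := by
  have h : Qᵀ * Q = 1 := (mem_orthogonalGroup_iff' _ _).1 hQ
  rw [dotProduct_mulVec, vecMul_mulVec, ← dotProduct_mulVec, h, one_mulVec]

theorem transpose_mem_orthogonalGroup {ι : Type*} [Fintype ι] [DecidableEq ι]
    {Q : Matrix ι ι ℝ} (hQ : Q ∈ orthogonalGroup ι ℝ) : Qᵀ ∈ orthogonalGroup ι ℝ :=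
  (mem_orthogonalGroup_iff' _ _).2 (by simpa using (mem_orthogonalGroup_iff _ _).1 hQ)

theorem norm_mulVec_le_of_forall_abs_le {ι : Type*} [Fintype ι] {M : Matrix ι ι ℝ} {e : ℝ}
    (he : 0 ≤ e) (hM : ∀ i j, |M i j| ≤ e) (v : ι → ℝ) :
    ‖WithLp.toLp 2 (M *ᵥ v)‖ ≤ Fintype.card ι * e * ‖WithLp.toLp 2 v‖ := by
  refine (sq_le_sq₀ (norm_nonneg _) (by positivity)).1 ?_
  rw [norm_toLp_sq, mul_pow, norm_toLp_sq]
  have h : ∀ i, (M *ᵥ v) i * (M *ᵥ v) i ≤ Fintype.card ι * e ^ 2 * (v ⬝ᵥ v) := fun i => by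
    have h1 := Finset.sum_mul_sq_le_sq_mul_sq Finset.univ (fun j => M i j) v
    have h2 : ∑ j, M i j ^ 2 ≤ Fintype.card ι * e ^ 2 := by
      refine (Finset.sum_le_card_nsmul _ _ (e ^ 2) fun j _ => ?_).trans (by simp)
      exact sq_le_sq' (by linarith [abs_le.1 (hM i j)]) (abs_le.1 (hM i j)).2
    have h3 : ∑ j, v j ^ 2 = v ⬝ᵥ v := by simp [dotProduct, pow_two]
    have h4 : 0 ≤ v ⬝ᵥ v := by rw [← h3]; positivity
    rw [h3] at h1
    rw [← pow_two]
    exact h1.trans (mul_le_mul_of_nonneg_right h2 h4)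
  refine (Finset.sum_le_card_nsmul _ _ _ fun i _ => h i).trans (le_of_eq ?_)
  simp only [Finset.card_univ, nsmul_eq_mul]
  ring

section Eigendecomposition

variable {n : ℕ} {G Q : Matrix (Fin n) (Fin n) ℝ} {ev : Fin n → ℝ}

/-- One half of the min-max principle: some nonzero `w` has an image orthogonal to the first `l`
eigenvectors, and on such vectors `G` stretches by at most `|ev l|`. The strict inequality in `hT`
already forces `T` to be injective. -/
theorem IsEigendecomposition.lt_abs_eigenvalue (h : IsEigendecomposition G Q ev) {W : Type*}
    [AddCommGroup W] [Module ℝ W] [FiniteDimensional ℝ W] (T : W →ₗ[ℝ] Fin n → ℝ) {t : ℝ}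
    (hT : ∀ w, w ≠ 0 → t * ‖WithLp.toLp 2 (T w)‖ < ‖WithLp.toLp 2 (G *ᵥ T w)‖)
    {l : Fin n} (hl : (l : ℕ) < Module.finrank ℝ W) : t < |ev l| := by
  obtain ⟨hQ, hG, hev⟩ := h
  let φ : W →ₗ[ℝ] Fin l → ℝ :=
    LinearMap.funLeft ℝ ℝ (Fin.castLE l.2.le) ∘ₗ Matrix.toLin' Qᵀ ∘ₗ T
  obtain ⟨w, hw, hw0⟩ := (Submodule.ne_bot_iff _).1
    (φ.ker_ne_bot_of_finrank_lt (by simpa using hl))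
  set c := Qᵀ *ᵥ T w with hc
  have hcl : ∀ j : Fin n, j < l → c j = 0 := fun j hj =>
    congrFun (LinearMap.mem_ker.1 hw) ⟨j, hj⟩
  have hGc : G *ᵥ T w = Q *ᵥ fun j => ev j * c j := by
    rw [hG, ← mulVec_mulVec, ← mulVec_mulVec, ← hc]
    congr 1
    ext j
    simp [mulVec_diagonal]
  have hle : ‖WithLp.toLp 2 (G *ᵥ T w)‖ ≤ |ev l| * ‖WithLp.toLp 2 (T w)‖ := by
    refine (sq_le_sq₀ (norm_nonneg _) (by positivity)).1 ?_
    rw [norm_toLp_sq, mul_pow, norm_toLp_sq, hGc, dotProduct_mulVec_self_of_orthogonal hQ,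
      ← dotProduct_mulVec_self_of_orthogonal (transpose_mem_orthogonalGroup hQ) (T w), ← hc,
      dotProduct, dotProduct, Finset.mul_sum]
    refine Finset.sum_le_sum fun j _ => ?_
    rcases lt_or_ge j l with hj | hj
    · simp [hcl j hj]
    · have := pow_le_pow_left₀ (abs_nonneg _) (hev hj) 2
      rw [sq_abs] at this
      nlinarith [mul_self_nonneg (c j)]
  exact lt_of_mul_lt_mul_right ((hT w hw0).trans_le hle) (norm_nonneg _)

/-- Multiplication by `Q` preserves the norm of rows, and `G * Q = Q * diagonal ev`. -/
theorem IsEigendecomposition.sum_sq_sub (h : IsEigendecomposition G Q ev) (i i' : Fin n) :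
    ∑ l, (ev l * (Q i l - Q i' l)) ^ 2 = ∑ j, (G i j - G i' j) ^ 2 := by
  obtain ⟨hQ, hG, -⟩ := h
  have hGQ : G * Q = Q * diagonal ev := by
    rw [hG, Matrix.mul_assoc, (mem_orthogonalGroup_iff' _ _).1 hQ, Matrix.mul_one]
  have hrow : ∀ i l, ∑ j, G i j * Q j l = ev l * Q i l := fun i l => by
    have := congrFun (congrFun hGQ i) l
    rw [mul_diagonal, Matrix.mul_apply] at this
    rw [this, mul_comm]
  have := dotProduct_mulVec_self_of_orthogonal (transpose_mem_orthogonalGroup hQ) (G i - G i')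
  simp only [dotProduct, ← pow_two, Pi.sub_apply] at this
  rw [← this]
  refine Finset.sum_congr rfl fun l _ => ?_
  rw [mul_sub, ← hrow, ← hrow, ← Finset.sum_sub_distrib]
  congr 1
  exact Finset.sum_congr rfl fun j _ => by simp; ring

theorem IsEigendecomposition.norm_embed_sub_le (h : IsEigendecomposition G Q ev) {L : ℕ} {t s : ℝ}
    (ht : 0 < t) (hev : ∀ l : Fin n, (l : ℕ) < L → t ≤ |ev l|) (hs : 0 ≤ s) {i i' : Fin n}
    (hG : ∑ j, (G i j - G i' j) ^ 2 ≤ s ^ 2) :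
    ‖embed Q ev L i - embed Q ev L i'‖ ≤ s / √t := by
  refine (sq_le_sq₀ (norm_nonneg _) (by positivity)).1 ?_
  rw [div_pow, Real.sq_sqrt ht.le, EuclideanSpace.norm_sq_eq]
  -- Extension by zero to all of `ℕ` allows sums over `Fin L` and `Fin n` to be compared whichever
  -- of `L`, `n` is larger.
  let g : ℕ → ℝ := fun l => if hl : l < n then
    (ev ⟨l, hl⟩ * (Q i ⟨l, hl⟩ - Q i' ⟨l, hl⟩)) ^ 2 / t else 0
  have hg : ∀ l, 0 ≤ g l := fun l => by
    simp only [g]; split_ifs <;> positivity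
  calc ∑ l : Fin L, ‖(embed Q ev L i - embed Q ev L i') l‖ ^ 2
      ≤ ∑ l : Fin L, g l := Finset.sum_le_sum fun l _ => by
        by_cases hl : (l : ℕ) < n
        · simp only [embed, WithLp.ofLp_sub, Pi.sub_apply, hl, dif_pos, g, ← mul_sub, norm_mul,
            mul_pow, Real.norm_eq_abs, sq_abs, Real.sq_sqrt (abs_nonneg _)]
          rw [le_div_iff₀ ht]
          have h1 := hev ⟨l, hl⟩ l.2
          have h2 := mul_le_mul_of_nonneg_left h1 (abs_nonneg (ev ⟨l, hl⟩))
          rw [abs_mul_abs_self, ← pow_two] at h2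
          nlinarith [sq_nonneg (Q i ⟨l, hl⟩ - Q i' ⟨l, hl⟩)]
        · simp [embed, hl, g]
    _ = ∑ l ∈ Finset.range L, g l := Finset.sum_range g |>.symm
    _ ≤ ∑ l ∈ Finset.range (L + n), g l := Finset.sum_le_sum_of_subset_of_nonneg
        (Finset.range_mono (by omega)) fun l _ _ => hg l
    _ = ∑ l ∈ Finset.range n, g l := (Finset.sum_subset (Finset.range_mono (by omega))
        fun l _ hl => dif_neg (by simpa using hl)).symm
    _ = ∑ l : Fin n, (ev l * (Q i l - Q i' l)) ^ 2 / t := by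
        rw [Finset.sum_range]; simp [g]
    _ ≤ s ^ 2 / t := by
        rw [← Finset.sum_div, h.sum_sq_sub]; gcongr

end Eigendecomposition

end Leapfrog

/-! ### Nonzero eigenvalues of symmetric matrices and their perturbation -/

namespace Leapfrog

open Matrix

section Symmetric

variable {ι : Type*} [Fintype ι] [DecidableEq ι] {M M' : Matrix ι ι ℝ}

theorem hasEigenvalue_toLin'_iff {z : ℝ} :
    Module.End.HasEigenvalue (toLin' M) z ↔ ∃ v, v ≠ 0 ∧ M *ᵥ v = z • v := by
  constructor
  · intro h
    obtain ⟨v, hv⟩ := h.exists_hasEigenvector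
    exact ⟨v, hv.2, by simpa using hv.apply_eq_smul⟩
  · rintro ⟨v, hv0, hv⟩
    exact Module.End.hasEigenvalue_of_hasEigenvector (x := v)
      ⟨Module.End.mem_eigenspace_iff.2 (by simpa using hv), hv0⟩

theorem exists_orthogonal_diagonalization (hM : M.IsHermitian) :
    ∃ U ∈ orthogonalGroup ι ℝ, ∃ ev : ι → ℝ, M = U * diagonal ev * Uᵀ ∧
      ∀ i, Module.End.HasEigenvalue (toLin' M) (ev i) := by
  refine ⟨hM.eigenvectorUnitary, hM.eigenvectorUnitary.2, hM.eigenvalues, ?_, fun i => ?_⟩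
  · conv_lhs => rw [hM.spectral_theorem, Unitary.conjStarAlgAut_apply]
    rfl
  · refine hasEigenvalue_toLin'_iff.2 ⟨hM.eigenvectorBasis i, fun h => ?_,
      hM.mulVec_eigenvectorBasis i⟩
    exact hM.eigenvectorBasis.orthonormal.ne_zero i (by ext j; exact congrFun h j)

theorem norm_sq_eq_sum_of_orthogonal {U : Matrix ι ι ℝ} (hU : U ∈ orthogonalGroup ι ℝ)
    (v : ι → ℝ) : ‖WithLp.toLp 2 v‖ ^ 2 = ∑ i, (Uᵀ *ᵥ v) i ^ 2 := by
  rw [norm_toLp_sq, ← dotProduct_mulVec_self_of_orthogonal (transpose_mem_orthogonalGroup hU) v]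
  simp [dotProduct, pow_two]

theorem transpose_mulVec_mulVec_of_diagonalization {U : Matrix ι ι ℝ}
    (hU : U ∈ orthogonalGroup ι ℝ) {ev : ι → ℝ} (hM : M = U * diagonal ev * Uᵀ) (v : ι → ℝ)
    (i : ι) : (Uᵀ *ᵥ (M *ᵥ v)) i = ev i * (Uᵀ *ᵥ v) i := by
  rw [mulVec_mulVec, hM, ← Matrix.mul_assoc, ← Matrix.mul_assoc,
    (mem_orthogonalGroup_iff' _ _).1 hU, Matrix.one_mul, ← mulVec_mulVec, mulVec_diagonal]

/-- The smallest magnitude of a nonzero eigenvalue of `M`. -/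
def minAbsEigenvalue (M : Matrix ι ι ℝ) : ℝ :=
  sInf {r : ℝ | ∃ z : ℝ, z ≠ 0 ∧ r = |z| ∧ Module.End.HasEigenvalue (toLin' M) z}

theorem minAbsEigenvalue_le {z : ℝ} (hz : z ≠ 0) (h : Module.End.HasEigenvalue (toLin' M) z) :
    minAbsEigenvalue M ≤ |z| :=
  csInf_le ⟨0, by rintro _ ⟨z, -, rfl, -⟩; exact abs_nonneg z⟩ ⟨z, hz, rfl, h⟩

theorem exists_eq_minAbsEigenvalue {z : ℝ} (hz : z ≠ 0)
    (h : Module.End.HasEigenvalue (toLin' M) z) :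
    ∃ y : ℝ, y ≠ 0 ∧ minAbsEigenvalue M = |y| ∧ Module.End.HasEigenvalue (toLin' M) y := by
  have hfin : {r : ℝ | ∃ z : ℝ, z ≠ 0 ∧ r = |z| ∧
      Module.End.HasEigenvalue (toLin' M) z}.Finite := by
    refine ((Module.End.finite_hasEigenvalue (toLin' M)).image abs).subset ?_
    rintro _ ⟨z, -, rfl, hz⟩
    exact ⟨z, hz, rfl⟩
  have hne : {r : ℝ | ∃ z : ℝ, z ≠ 0 ∧ r = |z| ∧
      Module.End.HasEigenvalue (toLin' M) z}.Nonempty := ⟨|z|, z, hz, rfl, h⟩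
  exact hne.csInf_mem hfin

theorem minAbsEigenvalue_pos {z : ℝ} (hz : z ≠ 0)
    (h : Module.End.HasEigenvalue (toLin' M) z) : 0 < minAbsEigenvalue M := by
  obtain ⟨y, hy, h, -⟩ := exists_eq_minAbsEigenvalue hz h
  rw [h]; exact abs_pos.2 hy

theorem minAbsEigenvalue_nonneg : 0 ≤ minAbsEigenvalue M :=
  Real.sInf_nonneg (by rintro _ ⟨z, -, rfl, -⟩; exact abs_nonneg z)

theorem exists_hasEigenvalue_ne_zero (hM : M.IsHermitian) (hr : M.rank ≠ 0) :
    ∃ z : ℝ, z ≠ 0 ∧ Module.End.HasEigenvalue (toLin' M) z := by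
  obtain ⟨U, hU, ev, hd, hev⟩ := exists_orthogonal_diagonalization hM
  by_contra! h
  have h0 : ev = 0 := funext fun i => by_contra fun hi => h _ hi (hev i)
  apply hr
  rw [hd, h0]
  simp

/-- A vector in the range has no component along eigenvectors of eigenvalue `0`. -/
theorem minAbsEigenvalue_mul_norm_le (hM : M.IsHermitian) {w : ι → ℝ}
    (hw : w ∈ LinearMap.range M.mulVecLin) :
    minAbsEigenvalue M * ‖WithLp.toLp 2 w‖ ≤ ‖WithLp.toLp 2 (M *ᵥ w)‖ := by
  obtain ⟨U, hU, ev, hd, hev⟩ := exists_orthogonal_diagonalization hM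
  obtain ⟨v, rfl⟩ := hw
  rw [mulVecLin_apply]
  refine (sq_le_sq₀ (mul_nonneg minAbsEigenvalue_nonneg (norm_nonneg _)) (norm_nonneg _)).1 ?_
  rw [mul_pow, norm_sq_eq_sum_of_orthogonal hU, norm_sq_eq_sum_of_orthogonal hU, Finset.mul_sum]
  refine Finset.sum_le_sum fun i _ => ?_
  rw [transpose_mulVec_mulVec_of_diagonalization hU hd (M *ᵥ v),
    transpose_mulVec_mulVec_of_diagonalization hU hd v]
  by_cases hi : ev i = 0
  · simp [hi]
  · rw [mul_pow (ev i) (ev i * _), ← sq_abs (ev i)]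
    gcongr
    · exact minAbsEigenvalue_nonneg
    · exact minAbsEigenvalue_le hi (hev i)

/-- For an eigenvector `v` of `M`, the residual `(M' - M) v` has coordinates `(ev i - z) * v i` in
an eigenbasis of `M'`. If every `ev i` were far from `z`, it would be too long. -/
theorem exists_hasEigenvalue_near (hM' : M'.IsHermitian) {z : ℝ}
    (hz : Module.End.HasEigenvalue (toLin' M) z) {e : ℝ} (he : 0 ≤ e)
    (h : ∀ i j, |M' i j - M i j| ≤ e) :
    ∃ z', Module.End.HasEigenvalue (toLin' M') z' ∧ |z' - z| ≤ Fintype.card ι * e := by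
  obtain ⟨U, hU, ev, hd, hev⟩ := exists_orthogonal_diagonalization hM'
  obtain ⟨v, hv0, hv⟩ := hasEigenvalue_toLin'_iff.1 hz
  by_contra! hcon
  have h1 := norm_mulVec_le_of_forall_abs_le (M := M' - M) he h v
  have h2 := pow_le_pow_left₀ (norm_nonneg _) h1 2
  have hpos : 0 < ∑ i, (Uᵀ *ᵥ v) i ^ 2 := by
    rw [← norm_sq_eq_sum_of_orthogonal hU]
    have : ‖WithLp.toLp 2 v‖ ≠ 0 := by simpa using hv0
    positivity
  obtain ⟨i, -, hi⟩ := Finset.exists_lt_of_sum_lt (s := Finset.univ) (f := fun _ => (0 : ℝ))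
    (g := fun i => (Uᵀ *ᵥ v) i ^ 2) (by simpa using hpos)
  rw [mul_pow, norm_sq_eq_sum_of_orthogonal hU, norm_sq_eq_sum_of_orthogonal hU,
    Finset.mul_sum] at h2
  refine absurd h2 (not_le.2 ?_)
  have hterm : ∀ i, (Uᵀ *ᵥ ((M' - M) *ᵥ v)) i = (ev i - z) * (Uᵀ *ᵥ v) i := fun i => by
    rw [sub_mulVec, mulVec_sub, hv, mulVec_smul, Pi.sub_apply,
      transpose_mulVec_mulVec_of_diagonalization hU hd, Pi.smul_apply, smul_eq_mul, sub_mul]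
  have hsq : ∀ i, (Fintype.card ι * e) ^ 2 < (ev i - z) ^ 2 := fun i => by
    rw [← sq_abs (ev i - z)]
    exact pow_lt_pow_left₀ (hcon _ (hev i)) (by positivity) two_ne_zero
  refine Finset.sum_lt_sum (fun j _ => ?_) ⟨i, Finset.mem_univ i, ?_⟩
  · rw [hterm, mul_pow (ev j - z)]
    exact mul_le_mul_of_nonneg_right (hsq j).le (sq_nonneg _)
  · rw [hterm, mul_pow (ev i - z)]
    exact mul_lt_mul_of_pos_right (hsq i) hi

/-- No lower bound beyond positivity can be expected: the kernel of `M` may give rise to tiny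
eigenvalues of `M'`. A smaller `σ` only weakens the final estimate, so the upper bound suffices. -/
theorem minAbsEigenvalue_perturb (hM : M.IsHermitian) (hM' : M'.IsHermitian) (hr : M.rank ≠ 0)
    {e : ℝ} (he : 0 ≤ e) (h : ∀ i j, |M' i j - M i j| ≤ e)
    (hsmall : Fintype.card ι * e < minAbsEigenvalue M) :
    0 < minAbsEigenvalue M' ∧
      minAbsEigenvalue M' ≤ minAbsEigenvalue M + Fintype.card ι * e := by
  obtain ⟨z, hz0, hz⟩ := exists_hasEigenvalue_ne_zero hM hr
  obtain ⟨y, hy0, hy, hyE⟩ := exists_eq_minAbsEigenvalue hz0 hz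
  obtain ⟨y', hyE', hyy⟩ := exists_hasEigenvalue_near hM' hyE he h
  have hy' : y' ≠ 0 := by
    rintro rfl
    rw [zero_sub, abs_neg] at hyy
    linarith
  refine ⟨minAbsEigenvalue_pos hy' hyE', (minAbsEigenvalue_le hy' hyE').trans ?_⟩
  linarith [abs_sub_abs_le_abs_sub y' y]

end Symmetric

/-! ### Block matrices and cluster-constant vectors -/

theorem isHermitian_diagonal_mul_mul_diagonal {ι : Type*} [Fintype ι] [DecidableEq ι]
    {B : Matrix ι ι ℝ} (hB : B.IsHermitian) (φ : ι → ℝ) :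
    (diagonal φ * B * diagonal φ).IsHermitian := by
  have := isHermitian_mul_mul_conjTranspose (diagonal φ) hB
  simpa [diagonal_conjTranspose] using this

theorem rank_diagonal_mul_mul_diagonal {ι : Type*} [Fintype ι] [DecidableEq ι]
    (B : Matrix ι ι ℝ) {φ : ι → ℝ} (hφ : ∀ k, φ k ≠ 0) :
    (diagonal φ * B * diagonal φ).rank = B.rank := by
  have hdet : IsUnit (diagonal φ).det := by
    rw [det_diagonal]; exact (Finset.prod_ne_zero_iff.2 fun k _ => hφ k).isUnit
  rw [rank_mul_eq_left_of_isUnit_det _ _ hdet, rank_mul_eq_right_of_isUnit_det _ _ hdet]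

/-- The number of indices that `κ` sends to `k`. -/
def fiberCard {n K : ℕ} (κ : Fin n → Fin K) (k : Fin K) : ℕ :=
  (Finset.univ.filter fun i => κ i = k).card

theorem sum_comp_eq_sum_fiberCard_mul {n K : ℕ} (κ : Fin n → Fin K) (f : Fin K → ℝ) :
    ∑ i, f (κ i) = ∑ k, fiberCard κ k * f k := by
  rw [← Finset.sum_fiberwise Finset.univ κ]
  refine Finset.sum_congr rfl fun k _ => ?_
  rw [Finset.sum_congr rfl fun i hi => by rw [(Finset.mem_filter.1 hi).2], Finset.sum_const,
    nsmul_eq_mul, fiberCard]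

/-- Lifts a vector indexed by clusters to a vector of the same norm that is constant on
clusters. -/
def liftVec {n K : ℕ} (κ : Fin n → Fin K) : (Fin K → ℝ) →ₗ[ℝ] (Fin n → ℝ) where
  toFun w i := w (κ i) / √(fiberCard κ (κ i))
  map_add' v w := by ext i; simp [add_div]
  map_smul' c w := by ext i; simp [mul_div_assoc]

theorem norm_liftVec {n K : ℕ} {κ : Fin n → Fin K} (hκ : ∀ k, 0 < fiberCard κ k)
    (w : Fin K → ℝ) : ‖WithLp.toLp 2 (liftVec κ w)‖ = ‖WithLp.toLp 2 w‖ := by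
  refine (sq_eq_sq₀ (norm_nonneg _) (norm_nonneg _)).1 ?_
  rw [norm_toLp_sq, norm_toLp_sq]
  refine (sum_comp_eq_sum_fiberCard_mul κ
    fun k => w k / √(fiberCard κ k) * (w k / √(fiberCard κ k))).trans ?_
  refine Finset.sum_congr rfl fun k _ => ?_
  have h : (0 : ℝ) < fiberCard κ k := by exact_mod_cast hκ k
  rw [div_mul_div_comm, Real.mul_self_sqrt h.le]
  field_simp

/-- `liftVec κ` is an isometry that intertwines `n` times the small scaled matrix with the block
matrix. -/
theorem norm_mulVec_liftVec {n K : ℕ} {κ : Fin n → Fin K} (hκ : ∀ k, 0 < fiberCard κ k)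
    (B : Matrix (Fin K) (Fin K) ℝ) (w : Fin K → ℝ) :
    ‖WithLp.toLp 2 ((Matrix.of fun i j => B (κ i) (κ j)) *ᵥ liftVec κ w)‖ =
      n * ‖WithLp.toLp 2 ((diagonal (fun k => √(fiberCard κ k / n)) * B *
        diagonal fun k => √(fiberCard κ k / n)) *ᵥ w)‖ := by
  refine (sq_eq_sq₀ (norm_nonneg _) (by positivity)).1 ?_
  rw [mul_pow, norm_toLp_sq, norm_toLp_sq]
  have hrow : ∀ i, ((Matrix.of fun i j => B (κ i) (κ j)) *ᵥ liftVec κ w) i =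
      ∑ m, B (κ i) m * √(fiberCard κ m) * w m := fun i => by
    refine (sum_comp_eq_sum_fiberCard_mul κ
      fun m => B (κ i) m * (w m / √(fiberCard κ m))).trans ?_
    refine Finset.sum_congr rfl fun m _ => ?_
    have h : (0 : ℝ) < √(fiberCard κ m) := Real.sqrt_pos.2 (by exact_mod_cast hκ m)
    have h2 : √(fiberCard κ m : ℝ) * √(fiberCard κ m) = fiberCard κ m :=
      Real.mul_self_sqrt (Nat.cast_nonneg _)
    field_simp
    rw [pow_two, h2]
    ring
  simp only [dotProduct, hrow]
  rw [sum_comp_eq_sum_fiberCard_mul κ fun k => (∑ m, B k m * √(fiberCard κ m) * w m) *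
    ∑ m, B k m * √(fiberCard κ m) * w m, Finset.mul_sum]
  refine Finset.sum_congr rfl fun k _ => ?_
  have hn : (0 : ℝ) < n := by
    have : n ≠ 0 := by
      rintro rfl
      have := hκ k
      simp [fiberCard] at this
    positivity
  have hk : ((diagonal (fun k => √(fiberCard κ k / n)) * B *
      diagonal fun k => √(fiberCard κ k / n)) *ᵥ w) k =
      √(fiberCard κ k) / n * ∑ m, B k m * √(fiberCard κ m) * w m := by
    simp only [mulVec, dotProduct, mul_diagonal, diagonal_mul, Finset.mul_sum]
    refine Finset.sum_congr rfl fun m _ => ?_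
    rw [Real.sqrt_div (Nat.cast_nonneg _), Real.sqrt_div (Nat.cast_nonneg _)]
    have h2 : √(n : ℝ) * √n = n := Real.mul_self_sqrt hn.le
    have h3 : 0 < √(n : ℝ) := Real.sqrt_pos.2 hn
    field_simp
    rw [pow_two, h2]
    ring
  rw [hk]
  have h2 : √(fiberCard κ k : ℝ) * √(fiberCard κ k) = fiberCard κ k :=
    Real.mul_self_sqrt (Nat.cast_nonneg _)
  generalize ∑ m, B k m * √(fiberCard κ m) * w m = X
  calc (fiberCard κ k : ℝ) * (X * X)
      = √(fiberCard κ k) * √(fiberCard κ k) * (X * X) := by rw [h2]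
    _ = _ := by field_simp

theorem IsEigendecomposition.lt_abs_of_near_block {n K : ℕ} {G Q : Matrix (Fin n) (Fin n) ℝ}
    {ev : Fin n → ℝ} (h : IsEigendecomposition G Q ev) {κ : Fin n → Fin K}
    (hκ : ∀ k, 0 < fiberCard κ k) {B : Matrix (Fin K) (Fin K) ℝ} (hB : B.IsHermitian)
    {φ : Fin K → ℝ} (hφ : ∀ k, φ k ≠ 0) {e e' : ℝ} (he : 0 ≤ e) (he' : 0 ≤ e')
    (hG : ∀ i j, |G i j - B (κ i) (κ j)| ≤ e)
    (hF : ∀ k m, |√(fiberCard κ k / n) * B k m * √(fiberCard κ m / n) - φ k * B k m * φ m| ≤ e')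
    (hsmall : e + K * e' < minAbsEigenvalue (diagonal φ * B * diagonal φ) / 2)
    {l : Fin n} (hl : (l : ℕ) < B.rank) :
    n * (minAbsEigenvalue (diagonal φ * B * diagonal φ) / 2) < |ev l| := by
  set M := diagonal φ * B * diagonal φ with hMdef
  have hn : (0 : ℝ) < n := by exact_mod_cast l.pos
  have hM : M.IsHermitian := isHermitian_diagonal_mul_mul_diagonal hB φ
  have hrank : M.rank = B.rank := rank_diagonal_mul_mul_diagonal B hφ
  refine h.lt_abs_eigenvalue (liftVec κ ∘ₗ (LinearMap.range M.mulVecLin).subtype) ?_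
    (hl.trans_eq hrank.symm)
  rintro ⟨w, hw⟩ hw0
  have hwpos : 0 < ‖WithLp.toLp 2 w‖ := by
    rw [norm_pos_iff]
    simpa using hw0
  simp only [LinearMap.comp_apply, Submodule.subtype_apply]
  set Bn : Matrix (Fin n) (Fin n) ℝ := Matrix.of fun i j => B (κ i) (κ j) with hBn
  set M' := diagonal (fun k => √(fiberCard κ k / n)) * B *
        diagonal fun k => √(fiberCard κ k / n) with hM'
  have h1 := norm_mulVec_le_of_forall_abs_le (M := Bn - G) he
    (fun i j => by
    rw [Matrix.sub_apply, abs_sub_comm]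
    simpa [hBn] using hG i j) (liftVec κ w)
  have h2 := norm_mulVec_le_of_forall_abs_le (M := M - M') he'
    (fun i j => by
    rw [Matrix.sub_apply, abs_sub_comm]
    simpa [hMdef, hM'] using hF i j) w
  have h3 := minAbsEigenvalue_mul_norm_le hM hw
  have h4 := norm_mulVec_liftVec hκ B w
  rw [← hBn, ← hM'] at h4
  rw [sub_mulVec, WithLp.toLp_sub] at h1 h2
  have h5 := norm_sub_norm_le (WithLp.toLp 2 (Bn *ᵥ liftVec κ w)) (WithLp.toLp 2 (G *ᵥ liftVec κ w))
  have h6 := norm_sub_norm_le (WithLp.toLp 2 (M *ᵥ w)) (WithLp.toLp 2 (M' *ᵥ w))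
  rw [norm_liftVec hκ] at h1 ⊢
  simp only [Fintype.card_fin] at h1 h2
  have h7 : n * ‖WithLp.toLp 2 (M' *ᵥ w)‖ ≥
      n * ((minAbsEigenvalue M - K * e') * ‖WithLp.toLp 2 w‖) :=
    mul_le_mul_of_nonneg_left (by linarith) hn.le
  -- An entrywise error `e` of an `n × n` matrix costs `n * e` in operator norm, the scale of the
  -- eigenvalues themselves, so fixed errors are affordable.
  have h8 : 0 < n * ‖WithLp.toLp 2 w‖ * (minAbsEigenvalue M / 2 - (e + K * e')) :=
    mul_pos (mul_pos hn hwpos) (by linarith)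
  linarith

end Leapfrog

/-! ### Gram matrices and properties of admissible densities -/

namespace Leapfrog

open Matrix

theorem abs_gram_sub_gram_le {ι κ : Type*} {A : Matrix ι ι ℝ} {B : Matrix κ κ ℝ} {p : ι → κ}
    {g : ℝ} (h : ∀ i j, |A i j - B (p i) (p j)| ≤ g) (o i j : ι) :
    |gram o A i j - gram (p o) B (p i) (p j)| ≤ 3 * g := by
  simp only [gram, Matrix.of_apply]
  have h1 := abs_le.1 (h i j)
  have h2 := abs_le.1 (h o i)
  have h3 := abs_le.1 (h o j)
  exact abs_le.2 ⟨by linarith [h1.1, h2.2, h3.2], by linarith [h1.2, h2.1, h3.1]⟩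

theorem abs_gram_sub_row_le {ι : Type*} {A : Matrix ι ι ℝ} {g : ℝ} {o i i' j : ι}
    (h : |A i j - A i' j| ≤ g) (h' : |A o i - A o i'| ≤ g) :
    |gram o A i j - gram o A i' j| ≤ 2 * g := by
  simp only [gram, Matrix.of_apply]
  have h1 := abs_le.1 h
  have h2 := abs_le.1 h'
  exact abs_le.2 ⟨by linarith [h1.1, h2.2], by linarith [h1.2, h2.1]⟩

theorem isHermitian_gram {ι : Type*} {A : Matrix ι ι ℝ} (hA : A.IsHermitian) (o : ι) :
    (gram o A).IsHermitian := by
  ext i j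
  have h := hA.apply i j
  simp only [star_trivial] at h
  simp only [gram, conjTranspose_apply, Matrix.of_apply, star_trivial, h]
  ring

theorem abs_sq_sub_sq_le {x y c g : ℝ} (hx : 0 ≤ x) (hy : 0 ≤ y) (hxc : x ≤ c) (hyc : y ≤ c)
    (h : |x - y| ≤ g) : |x ^ 2 - y ^ 2| ≤ 2 * c * g := by
  rw [sq_sub_sq, abs_mul, abs_of_nonneg (add_nonneg hx hy)]
  exact mul_le_mul (by linarith) h (abs_nonneg _) (by linarith)

theorem exists_abs_sqrt_mul_mul_sqrt_sub_le {ι : Type*} [Fintype ι] (B : Matrix ι ι ℝ) (p : ι → ℝ)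
    {e : ℝ} (he : 0 < e) :
    ∃ δ > 0, ∀ x : ι → ℝ, (∀ k, |x k - p k| ≤ δ) →
      ∀ k m, |√(x k) * B k m * √(x m) - √(p k) * B k m * √(p m)| ≤ e := by
  have hev : ∀ᶠ x in nhds p, ∀ k m,
      |√(x k) * B k m * √(x m) - √(p k) * B k m * √(p m)| < e := by
    refine Filter.eventually_all.2 fun k => Filter.eventually_all.2 fun m => ?_
    have hc : Continuous fun x : ι → ℝ =>
        |√(x k) * B k m * √(x m) - √(p k) * B k m * √(p m)| := by fun_prop
    exact hc.continuousAt.eventually_lt_const (by simpa using he)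
  obtain ⟨δ, hδ, h⟩ := Metric.eventually_nhds_iff.1 hev
  refine ⟨δ / 2, by positivity, fun x hx k m => (h ?_ k m).le⟩
  exact ((dist_pi_le_iff (by positivity)).2 fun k => by rw [Real.dist_eq]; exact hx k).trans_lt
    (half_lt_self hδ)

theorem edist_le_pathDist {d : ℕ} (T : Set (EuclideanSpace ℝ (Fin d)))
    (x y : EuclideanSpace ℝ (Fin d)) : edist x y ≤ pathDist T x y :=
  le_iInf₂ fun g _ => by
    simpa using eVariationOn.edist_le (fun t : unitInterval => g t) (Set.mem_univ 0)
      (Set.mem_univ 1)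

namespace IsAdmissible

variable {d K : ℕ} {f : EuclideanSpace ℝ (Fin d) → ℝ} {S : Fin K → Set (EuclideanSpace ℝ (Fin d))}
  {ell : ℝ}

/-- Otherwise clusters would be single points, which are null sets in positive dimension, against
`no_cusp`. -/
theorem ell_pos (hf : IsAdmissible f S ell) (hd : 0 < d) (k : Fin K) : 0 < ell := by
  by_contra! h
  obtain ⟨r₀, p, hr₀, hp, hv⟩ := hf.no_cusp
  obtain ⟨x, hx⟩ := (hf.isPathConnected k).nonempty
  have hsub : Metric.closedBall x r₀ ∩ S k ⊆ {x} := fun y hy => by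
    have := (edist_le_pathDist (S k) y x).trans (hf.pathDist_le k y hy.2 x hx)
    rw [ENNReal.ofReal_of_nonpos h] at this
    exact edist_le_zero.1 this
  have : Nonempty (Fin d) := ⟨⟨0, hd⟩⟩
  have h0 : volume (Metric.closedBall x r₀ ∩ S k) = 0 := measure_mono_null hsub (by simp)
  have := hv k x hx r₀ hr₀ le_rfl
  rw [h0, nonpos_iff_eq_zero, ENNReal.ofReal_eq_zero] at this
  exact absurd this (not_le.2 (by positivity))

theorem isProbabilityMeasure_law (hf : IsAdmissible f S ell) : IsProbabilityMeasure (law f) :=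
  ⟨by rw [law, withDensity_apply _ MeasurableSet.univ, setLIntegral_univ, hf.lintegral_eq_one]⟩

theorem measurableSet (hf : IsAdmissible f S ell) (k : Fin K) : MeasurableSet (S k) :=
  (hf.isCompact k).measurableSet

theorem law_compl_iUnion (hf : IsAdmissible f S ell) : law f (⋃ k, S k)ᶜ = 0 := by
  rw [law, withDensity_apply _ (MeasurableSet.iUnion hf.measurableSet).compl,
    setLIntegral_eq_zero (MeasurableSet.iUnion hf.measurableSet).compl]
  intro x hx
  rw [← hf.support_eq] at hx
  simp [Function.notMem_support.1 hx]

theorem exists_law_closedBall_inter_ge (hf : IsAdmissible f S ell) :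
    ∃ r₀ p : ℝ, 0 < r₀ ∧ 0 < p ∧ ∀ k, ∀ x ∈ S k, ∀ r : ℝ, 0 < r → r ≤ r₀ →
      p * r ^ d ≤ (law f).real (Metric.closedBall x r ∩ S k) := by
  have := hf.isProbabilityMeasure_law
  obtain ⟨r₀, p, hr₀, hp, hv⟩ := hf.no_cusp
  obtain ⟨θ, hθ, hfθ⟩ := hf.bounded_below
  refine ⟨r₀, θ * p, hr₀, by positivity, fun k x hx r hr hrr => ?_⟩
  have hA : MeasurableSet (Metric.closedBall x r ∩ S k) :=
    Metric.isClosed_closedBall.measurableSet.inter (hf.measurableSet k)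
  have h1 : ENNReal.ofReal θ * volume (Metric.closedBall x r ∩ S k) ≤
      law f (Metric.closedBall x r ∩ S k) := by
    rw [law, withDensity_apply _ hA, ← setLIntegral_const]
    refine setLIntegral_mono' hA fun y hy => ENNReal.ofReal_le_ofReal (hfθ y ?_)
    rw [hf.support_eq]
    exact Set.mem_iUnion_of_mem k hy.2
  rw [Measure.real, ← ENNReal.ofReal_le_iff_le_toReal (measure_ne_top _ _), mul_assoc,
    ENNReal.ofReal_mul hθ.le]
  exact (mul_le_mul_right (hv k x hx r hr hrr) _).trans h1

theorem law_real_pos (hf : IsAdmissible f S ell) (k : Fin K) : 0 < (law f).real (S k) := by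
  have := hf.isProbabilityMeasure_law
  obtain ⟨r₀, p, hr₀, hp, h⟩ := hf.exists_law_closedBall_inter_ge
  obtain ⟨x, hx⟩ := (hf.isPathConnected k).nonempty
  have h1 : 0 < p * r₀ ^ d := by positivity
  exact h1.trans_le ((h k x hx r₀ hr₀ le_rfl).trans (measureReal_mono Set.inter_subset_right))

theorem dist_le_diam (hf : IsAdmissible f S ell) {x y : EuclideanSpace ℝ (Fin d)} {k m : Fin K}
    (hx : x ∈ S k) (hy : y ∈ S m) : dist x y ≤ Metric.diam (⋃ k, S k) :=
  Metric.dist_le_diam_of_mem (isCompact_iUnion hf.isCompact).isBounded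
    (Set.mem_iUnion_of_mem k hx) (Set.mem_iUnion_of_mem m hy)

theorem LF_le (hf : IsAdmissible f S ell) {n : ℕ} {a : Fin n → EuclideanSpace ℝ (Fin d)}
    {κ : Fin n → Fin K} (hκ : ∀ i, a i ∈ S (κ i)) (i j : Fin n) :
    LF a i j ≤ Metric.diam (⋃ k, S k) ^ 2 :=
  (LF_le_sq a i j).trans (pow_le_pow_left₀ dist_nonneg (hf.dist_le_diam (hκ i) (hκ j)) 2)

theorem eq_of_mem (hf : IsAdmissible f S ell) {x : EuclideanSpace ℝ (Fin d)} {k m : Fin K}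
    (hk : x ∈ S k) (hm : x ∈ S m) : k = m := by
  by_contra h
  exact Set.disjoint_left.1 (hf.disjoint h) hk hm

end IsAdmissible

theorem isHermitian_limitSqLF {d K : ℕ} (S : Fin K → Set (EuclideanSpace ℝ (Fin d))) :
    (limitSqLF S).IsHermitian := by
  ext k m
  change limitLF S m k ^ 2 = limitLF S k m ^ 2
  rw [limitLF_comm]

theorem isHermitian_repSqLF {d n K : ℕ} (a : Fin n → EuclideanSpace ℝ (Fin d))
    (rep : Fin K → Fin n) : (repSqLF a rep).IsHermitian := by
  ext k m
  change LF a (rep m) (rep k) ^ 2 = LF a (rep k) (rep m) ^ 2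
  rw [LF_comm]

theorem sigma_eq {d K : ℕ} (f : EuclideanSpace ℝ (Fin d) → ℝ)
    (S : Fin K → Set (EuclideanSpace ℝ (Fin d))) (o : Fin K) (A : Matrix (Fin K) (Fin K) ℝ) :
    sigma f S o A = minAbsEigenvalue (sqrtMass f S * gram o A * sqrtMass f S) / 2 := rfl

end Leapfrog

/-! ### The embedding bound for good samples -/

namespace Leapfrog

open Matrix

/-- The factors `√n` cancel. The `24` is `6 * 4`, since the rate is `4 * ε`. Requiring only `σ ≤ μ`
(the limiting value is `μ / 2`) leaves room for the `σ` of the representatives. -/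
theorem sqrt_mul_div_sqrt_le {n μ σ L c : ℝ} (hn : 0 < n) (hμ : 0 < μ) (hσ : 0 < σ) (hσμ : σ ≤ μ)
    (hL : 1 ≤ L) (hc : 0 ≤ c) : √n * (2 * c) / √(n * (μ / 2)) ≤ 24 * c * √L / √σ := by
  have hsn : 0 < √n := Real.sqrt_pos.2 hn
  have hsμ : 0 < √(μ / 2) := Real.sqrt_pos.2 (by positivity)
  have hsσ : 0 < √σ := Real.sqrt_pos.2 hσ
  have h2 : √σ ≤ 2 * √(μ / 2) := by
    refine Real.sqrt_le_iff.2 ⟨by positivity, ?_⟩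
    rw [mul_pow, Real.sq_sqrt (by positivity)]
    linarith
  have hL1 : 1 ≤ √L := Real.one_le_sqrt.2 hL
  rw [Real.sqrt_mul hn.le, mul_div_mul_left _ _ hsn.ne', div_le_div_iff₀ hsμ hsσ]
  calc 2 * c * √σ ≤ 2 * c * (2 * √(μ / 2)) := by gcongr
    _ = 4 * c * 1 * √(μ / 2) := by ring
    _ ≤ 24 * c * √L * √(μ / 2) := by gcongr; norm_num

variable {d K : ℕ} {f : EuclideanSpace ℝ (Fin d) → ℝ}
  {S : Fin K → Set (EuclideanSpace ℝ (Fin d))} {ell : ℝ}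

namespace IsAdmissible

theorem fiberCard_pos (hf : IsAdmissible f S ell) {n : ℕ} {a : Fin n → EuclideanSpace ℝ (Fin d)}
    {κ : Fin n → Fin K} (hκ : ∀ i, a i ∈ S (κ i)) {ε : ℝ} (ha : IsDenseSample S a ε) (k : Fin K) :
    0 < fiberCard κ k := by
  obtain ⟨i, hi, -⟩ := ha k _ (hf.isPathConnected k).nonempty.some_mem
  exact Finset.card_pos.2 ⟨i, Finset.mem_filter.2 ⟨Finset.mem_univ i, hf.eq_of_mem (hκ i) hi⟩⟩

theorem abs_sqLF_sub_limitSqLF_le (hf : IsAdmissible f S ell) {n : ℕ}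
    {a : Fin n → EuclideanSpace ℝ (Fin d)} {κ : Fin n → Fin K} (hκ : ∀ i, a i ∈ S (κ i)) {g : ℝ}
    (h : ∀ i j, LF a i j ≤ limitLF S (κ i) (κ j) + g) (i j : Fin n) :
    |LF a i j ^ 2 - limitSqLF S (κ i) (κ j)| ≤ 2 * Metric.diam (⋃ k, S k) ^ 2 * g := by
  have h1 := limitLF_le_LF hκ i j
  refine abs_sq_sub_sq_le (LF_nonneg a i j) (limitLF_nonneg (S := S) _ _) (hf.LF_le hκ i j)
    (h1.trans (hf.LF_le hκ i j)) ?_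
  change |LF a i j - limitLF S (κ i) (κ j)| ≤ g
  rw [abs_of_nonneg (by linarith)]
  linarith [h i j]

/-- The triangle inequality bounds the change of `LF` by `g`, squaring costs `2 * diam ^ 2`, and the
entry and its base term both change. With `g = 36 * ell * ε` this is `2 * c_g * ε`. -/
theorem abs_gram_sqLF_sub_row_le (hf : IsAdmissible f S ell) {n : ℕ}
    {a : Fin n → EuclideanSpace ℝ (Fin d)} {κ : Fin n → Fin K} (hκ : ∀ i, a i ∈ S (κ i)) {g : ℝ}
    {i i' : Fin n} (h : LF a i i' ≤ g) (o j : Fin n) :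
    |gram o (sqLF a) i j - gram o (sqLF a) i' j| ≤ 4 * Metric.diam (⋃ k, S k) ^ 2 * g := by
  have key : ∀ j, |LF a i j ^ 2 - LF a i' j ^ 2| ≤ 2 * Metric.diam (⋃ k, S k) ^ 2 * g := fun j => by
    refine abs_sq_sub_sq_le (LF_nonneg a i j) (LF_nonneg a i' j) (hf.LF_le hκ i j)
      (hf.LF_le hκ i' j) (abs_le.2 ⟨?_, ?_⟩)
    · linarith [LF_triangle a i' i j, LF_comm a i i']
    · linarith [LF_triangle a i i' j]
  refine (abs_gram_sub_row_le (A := sqLF a) (key j) ?_).trans_eq (by ring)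
  simp only [sqLF, Matrix.of_apply, LF_comm a o]
  exact key o

theorem sqrtMass_eq : sqrtMass f S = diagonal fun k => √((law f).real (S k)) := rfl

theorem abs_scaled_sub_le (hf : IsAdmissible f S ell) {A B : Matrix (Fin K) (Fin K) ℝ} {g : ℝ}
    {k m : Fin K} (h : |A k m - B k m| ≤ g) :
    |(sqrtMass f S * A * sqrtMass f S) k m - (sqrtMass f S * B * sqrtMass f S) k m| ≤ g := by
  have := hf.isProbabilityMeasure_law
  have h1 : ∀ k, √((law f).real (S k)) ≤ 1 := fun k => Real.sqrt_le_one.2 measureReal_le_one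
  simp only [sqrtMass, mul_diagonal, diagonal_mul]
  rw [← sub_mul, ← mul_sub, abs_mul, abs_mul, abs_of_nonneg (Real.sqrt_nonneg _),
    abs_of_nonneg (Real.sqrt_nonneg _)]
  have h2 : √((law f).real (S k)) * |A k m - B k m| ≤ 1 * g :=
    mul_le_mul (h1 k) h (abs_nonneg _) zero_le_one
  have h3 := mul_le_mul h2 (h1 m) (Real.sqrt_nonneg _)
    (by rw [one_mul]; exact (abs_nonneg _).trans h)
  simpa using h3

theorem exists_embed_bound_of_base (hf : IsAdmissible f S ell) (hd : 0 < d) (o : Fin K) :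
    ∃ δ > 0, ∃ ε₀ > 0, ∀ (n : ℕ) [NeZero n] (a : Fin n → EuclideanSpace ℝ (Fin d))
      (κ : Fin n → Fin K) (ε : ℝ), (∀ i, a i ∈ S (κ i)) → κ 0 = o → 0 < ε → ε ≤ ε₀ →
      IsDenseSample S a ε → (∀ k, |fiberCard κ k / n - (law f).real (S k)| ≤ δ) →
      ∀ (Q : Matrix (Fin n) (Fin n) ℝ) (ev : Fin n → ℝ),
        IsEigendecomposition (gram 0 (sqLF a)) Q ev → ∀ i i', κ i = κ i' →
        ∀ σ, σ = sigma f S o (limitSqLF S) ∨ (∃ rep : Fin K → Fin n, (∀ m, a (rep m) ∈ S m) ∧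
            σ = sigma f S o (repSqLF a rep)) →
          ‖embed Q ev (embDim S o) i - embed Q ev (embDim S o) i'‖ ≤
            6 * cg S ell * √(embDim S o) / √σ * (4 * ε) := by
  -- For `L = 0` the embedding space is a point; otherwise `F B F` has a nonzero eigenvalue and `μ >
  -- 0`.
  rcases Nat.eq_zero_or_pos (embDim S o) with hL | hL
  · refine ⟨1, one_pos, 1, one_pos, fun n _ a κ ε _ _ _ _ _ _ Q ev _ i i' _ σ _ => ?_⟩
    rw [EuclideanSpace.norm_eq]
    have : IsEmpty (Fin (embDim S o)) := by rw [hL]; infer_instance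
    simp [hL]
  have hell := hf.ell_pos hd o
  set B := gram o (limitSqLF S) with hB
  have hBH : B.IsHermitian := isHermitian_gram (isHermitian_limitSqLF S) o
  set M := sqrtMass f S * B * sqrtMass f S with hM
  have hMH : M.IsHermitian := isHermitian_diagonal_mul_mul_diagonal hBH _
  have hφ : ∀ k, √((law f).real (S k)) ≠ 0 := fun k => (Real.sqrt_pos.2 (hf.law_real_pos k)).ne'
  have hMr : M.rank ≠ 0 := by
    rw [hM, sqrtMass_eq, rank_diagonal_mul_mul_diagonal B hφ]
    exact hL.ne'
  obtain ⟨z, hz0, hz⟩ := exists_hasEigenvalue_ne_zero hMH hMr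
  set μ := minAbsEigenvalue M with hμdef
  have hμ : 0 < μ := minAbsEigenvalue_pos hz0 hz
  set R := Metric.diam (⋃ k, S k) with hR
  have hR0 : 0 ≤ R := Metric.diam_nonneg
  -- Chosen so that the Gram error `g` and the frequency error `K * g` add up to `μ / 8`.
  set g := μ / (8 * (K + 1)) with hg
  have hg0 : 0 < g := by positivity
  have hgK : g + K * g = μ / 8 := by rw [hg]; field_simp; ring
  have hKg : 0 ≤ K * g := by positivity
  obtain ⟨δ, hδ, hδ'⟩ := exists_abs_sqrt_mul_mul_sqrt_sub_le B (fun k => (law f).real (S k)) hg0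
  obtain ⟨ε₀, hε₀, hLF⟩ := exists_LF_le_limitLF (S := S)
    (fun k => (hf.isPathConnected k).nonempty) (36 * ell)
    -- Squaring multiplies the error by `2 * R ^ 2` and the Gram matrix triples it, leaving at most
    -- `g`; the `+ 1` covers `R = 0`.
    (show 0 < g / (6 * R ^ 2 + 1) by positivity)
  refine ⟨δ, hδ, min ε₀ ell, by positivity, fun n _ a κ ε hκ hκ0 hε hεl ha hcount Q ev hQ i i' hii
    σ hσ => ?_⟩
  have hintra : ∀ k i i', a i ∈ S k → a i' ∈ S k → LF a i i' ≤ 36 * ell * ε := fun k i i' hi hi' =>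
    LF_le_of_pathDist_le hell hε (hεl.trans (min_le_right _ _)) hf.pathDist_le ha hi hi'
  have hclose : ∀ i j, |LF a i j ^ 2 - limitSqLF S (κ i) (κ j)| ≤ g / 3 := fun i j => by
    refine (hf.abs_sqLF_sub_limitSqLF_le hκ (fun i j => hLF ε hε (hεl.trans (min_le_left _ _)) a ha
      hintra _ _ i j (hκ i) (hκ j)) i j).trans ?_
    rw [← hR, mul_div_assoc', div_le_div_iff₀ (by positivity) (by positivity)]
    nlinarith
  have hκpos := hf.fiberCard_pos hκ ha
  have hev : ∀ l : Fin n, (l : ℕ) < embDim S o → n * (μ / 2) < |ev l| := fun l hl => by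
    refine hQ.lt_abs_of_near_block hκpos hBH hφ hg0.le hg0.le ?_ (hδ' _ hcount) ?_ hl
    · intro i j
      have := abs_gram_sub_gram_le (A := sqLF a) (B := limitSqLF S) (p := κ) hclose 0 i j
      rw [hκ0] at this
      exact this.trans_eq (by ring)
    · change g + K * g < μ / 2
      linarith
  have hn : (0 : ℝ) < n := by exact_mod_cast Nat.pos_of_ne_zero (NeZero.ne n)
  have hσbd : 0 < σ ∧ σ ≤ μ := by
    rcases hσ with rfl | ⟨rep, hrep, rfl⟩
    · rw [sigma_eq]
      change 0 < μ / 2 ∧ μ / 2 ≤ μ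
      exact ⟨by positivity, by linarith⟩
    · have hrepκ : ∀ m, κ (rep m) = m := fun m => hf.eq_of_mem (hκ _) (hrep m)
      have hrc : ∀ k m, |repSqLF a rep k m - limitSqLF S k m| ≤ g / 3 := fun k m => by
        have := hclose (rep k) (rep m)
        rwa [hrepκ, hrepκ] at this
      obtain ⟨h1, h2⟩ := minAbsEigenvalue_perturb hMH
        (isHermitian_diagonal_mul_mul_diagonal
          (isHermitian_gram (isHermitian_repSqLF a rep) o) fun k => √((law f).real (S k)))
        hMr hg0.le (fun k m => hf.abs_scaled_sub_le
          ((abs_gram_sub_gram_le (p := id) hrc o k m).trans_eq (by ring)))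
        (by rw [Fintype.card_fin]; linarith)
      rw [Fintype.card_fin] at h2
      rw [sigma_eq, sqrtMass_eq]
      exact ⟨by positivity, by linarith⟩
  have hrow : ∑ j, (gram 0 (sqLF a) i j - gram 0 (sqLF a) i' j) ^ 2 ≤
      (√n * (2 * cg S ell * ε)) ^ 2 := by
    have h1 : ∀ j, (gram 0 (sqLF a) i j - gram 0 (sqLF a) i' j) ^ 2 ≤ (2 * cg S ell * ε) ^ 2 :=
      fun j => by
        rw [← sq_abs]
        refine pow_le_pow_left₀ (abs_nonneg _) ?_ 2
        refine (hf.abs_gram_sqLF_sub_row_le hκ (hintra (κ i) i i' (hκ i) (hii ▸ hκ i'))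
          0 j).trans_eq ?_
        rw [cg]; ring
    refine (Finset.sum_le_card_nsmul _ _ _ fun j _ => h1 j).trans_eq ?_
    rw [mul_pow (√n), Real.sq_sqrt hn.le, nsmul_eq_mul, Finset.card_univ, Fintype.card_fin]
  have hcg : 0 ≤ cg S ell := by rw [cg]; positivity
  have hb := hQ.norm_embed_sub_le (by positivity) (fun l hl => (hev l hl).le) (by positivity) hrow
  have hL1 : (1 : ℝ) ≤ embDim S o := by exact_mod_cast hL
  refine hb.trans ((sqrt_mul_div_sqrt_le hn hμ hσbd.1 hσbd.2 hL1 (c := cg S ell * ε)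
    (by positivity)).trans_eq' (by ring_nf) |>.trans_eq (by ring))

end IsAdmissible

end Leapfrog

/-! ### Probability that a sample is good -/

namespace Leapfrog

variable {d K : ℕ} {f : EuclideanSpace ℝ (Fin d) → ℝ}
  {S : Fin K → Set (EuclideanSpace ℝ (Fin d))} {ell : ℝ}

/-- A set in which every `r`-separated finite subset has at most `N` elements has an `r`-net of
at most `N` elements. -/
theorem exists_finset_net {X : Type*} [MetricSpace X] {T : Set X} {r : ℝ} (hr : 0 ≤ r) {N : ℕ}
    (h : ∀ C : Finset X, ↑C ⊆ T → (C : Set X).Pairwise (fun x y => r < dist x y) → C.card ≤ N) :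
    ∃ C : Finset X, ↑C ⊆ T ∧ C.card ≤ N ∧ ∀ x ∈ T, ∃ y ∈ C, dist x y ≤ r := by
  classical
  let P : ℕ → Prop := fun m => ∃ C : Finset X, ↑C ⊆ T ∧
    (C : Set X).Pairwise (fun x y => r < dist x y) ∧ C.card = m
  -- A separated set of largest cardinality is a net: a point far from all its elements could be
  -- added.
  have hP : P (Nat.findGreatest P N) :=
    Nat.findGreatest_spec (Nat.zero_le N) ⟨∅, by simp, by simp, by simp⟩
  obtain ⟨C, hCT, hC, hcard⟩ := hP
  refine ⟨C, hCT, h C hCT hC, fun x hx => ?_⟩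
  by_contra! hfar
  have hsub : ((insert x C : Finset X) : Set X) ⊆ T := by
    rw [Finset.coe_insert]; exact Set.insert_subset hx hCT
  have hsep : ((insert x C : Finset X) : Set X).Pairwise (fun x y => r < dist x y) := by
    rw [Finset.coe_insert]
    exact hC.insert fun y hy _ => ⟨hfar y hy, by rw [dist_comm]; exact hfar y hy⟩
  have hxC : x ∉ C := fun hxC => by
    have := hfar x hxC
    rw [dist_self] at this
    linarith
  have h1 : Nat.findGreatest P N + 1 ≤ Nat.findGreatest P N :=
    Nat.le_findGreatest
      (by rw [← hcard, ← Finset.card_insert_of_notMem hxC]; exact h _ hsub hsep)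
      ⟨_, hsub, hsep, by rw [Finset.card_insert_of_notMem hxC, hcard]⟩
  omega

/-- The balls of radius `r / 3` are disjoint, and their total mass is at most `1`. -/
theorem mul_card_le_one_of_separated {X : Type*} [MetricSpace X] [MeasurableSpace X]
    [OpensMeasurableSpace X] {ν : Measure X} [IsProbabilityMeasure ν] {T : Set X}
    (hT : MeasurableSet T) {r q : ℝ}
    (hq : ∀ x ∈ T, q ≤ ν.real (Metric.closedBall x (r / 3) ∩ T)) (hr : 0 < r) {C : Finset X}
    (hCT : ↑C ⊆ T) (hC : (C : Set X).Pairwise fun x y => r < dist x y) : C.card * q ≤ 1 := by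
  have hdisj : (C : Set X).PairwiseDisjoint fun x => Metric.closedBall x (r / 3) ∩ T :=
    fun x hx y hy hxy => by
      refine (Metric.closedBall_disjoint_closedBall ?_).mono Set.inter_subset_left
        Set.inter_subset_left
      linarith [hC hx hy hxy]
  have h1 := measureReal_biUnion_finset (μ := ν) hdisj
    fun x _ => Metric.isClosed_closedBall.measurableSet.inter hT
  have h2 : C.card • q ≤ ∑ x ∈ C, ν.real (Metric.closedBall x (r / 3) ∩ T) :=
    Finset.card_nsmul_le_sum _ _ _ fun x hx => hq x (hCT hx)
  rw [← h1, nsmul_eq_mul] at h2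
  exact h2.trans measureReal_le_one

namespace IsAdmissible

theorem sampleLaw_forall_notMem_le (hf : IsAdmissible f S ell) (n : ℕ)
    {A : Set (EuclideanSpace ℝ (Fin d))} (hA : MeasurableSet A) {q : ℝ}
    (hq : q ≤ (law f).real A) :
    sampleLaw f n {a | ∀ i, a i ∉ A} ≤ ENNReal.ofReal (Real.exp (-(n * q))) := by
  have := hf.isProbabilityMeasure_law
  have h1 : {a : Fin n → EuclideanSpace ℝ (Fin d) | ∀ i, a i ∉ A} =
      Set.univ.pi fun _ => Aᶜ := by ext a; simp
  have h2 : law f Aᶜ ≤ ENNReal.ofReal (Real.exp (-q)) := by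
    rw [← ofReal_measureReal, probReal_compl_eq_one_sub hA]
    exact ENNReal.ofReal_le_ofReal (by linarith [Real.add_one_le_exp (-q)])
  rw [h1, sampleLaw, Measure.pi_pi, Finset.prod_const, Finset.card_univ, Fintype.card_fin,
    show -(n * q) = n * (-q) by ring, Real.exp_nat_mul, ENNReal.ofReal_pow (Real.exp_pos _).le]
  exact pow_le_pow_left₀ zero_le h2 n

theorem sampleLaw_exists_notMem_iUnion (hf : IsAdmissible f S ell) (n : ℕ) :
    sampleLaw f n {a | ∃ i, a i ∉ ⋃ k, S k} = 0 := by
  have := hf.isProbabilityMeasure_law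
  rw [Set.ofPred_exists]
  refine measure_iUnion_null fun i => ?_
  have h := (measurePreserving_eval (fun _ : Fin n => law f) i).measure_preimage
    (MeasurableSet.iUnion hf.measurableSet).compl.nullMeasurableSet
  exact h.trans hf.law_compl_iUnion

/-- If the ball of radius `r` about each point of an `r`-net of `S k` contains a data point of `S
k`, the sample is `2 * r`-dense. The factor `(p * (r / 3) ^ d)⁻¹` bounds the size of the net. -/
theorem exists_sampleLaw_not_isDenseSample_le (hf : IsAdmissible f S ell) :
    ∃ r₀ p : ℝ, 0 < r₀ ∧ 0 < p ∧ ∀ (n : ℕ) (r : ℝ), 0 < r → r ≤ r₀ →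
      sampleLaw f n {a | ¬ IsDenseSample S a (2 * r)} ≤
        ENNReal.ofReal (K * ((p * (r / 3) ^ d)⁻¹ * Real.exp (-(n * (p * r ^ d))))) := by
  have := hf.isProbabilityMeasure_law
  obtain ⟨r₀, p, hr₀, hp, h⟩ := hf.exists_law_closedBall_inter_ge
  refine ⟨r₀, p, hr₀, hp, fun n r hr hrr => ?_⟩
  have hq : 0 < p * (r / 3) ^ d := by positivity
  have hnet : ∀ k, ∃ C : Finset (EuclideanSpace ℝ (Fin d)), ↑C ⊆ S k ∧
      C.card ≤ ⌊(p * (r / 3) ^ d)⁻¹⌋₊ ∧ ∀ x ∈ S k, ∃ y ∈ C, dist x y ≤ r := fun k =>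
    exists_finset_net hr.le fun C hCT hC => Nat.le_floor <| by
      rw [← one_div, le_div_iff₀ hq]
      exact mul_card_le_one_of_separated (hf.measurableSet k)
        (fun x hx => h k x hx (r / 3) (by positivity) (by linarith)) hr hCT hC
  choose C hCS hcard hC using hnet
  have hsub : {a : Fin n → EuclideanSpace ℝ (Fin d) | ¬ IsDenseSample S a (2 * r)} ⊆
      ⋃ k, ⋃ y ∈ C k, {a | ∀ i, a i ∉ Metric.closedBall y r ∩ S k} := fun a ha => by
    by_contra hcon
    simp only [Set.mem_iUnion, Set.mem_ofPred_eq, not_exists, not_forall, not_not] at hcon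
    refine ha fun k x hx => ?_
    obtain ⟨y, hy, hxy⟩ := hC k x hx
    obtain ⟨i, hi⟩ := hcon k y hy
    refine ⟨i, hi.2, ?_⟩
    linarith [dist_triangle_right (a i) x y, Metric.mem_closedBall.1 hi.1]
  have hmiss : ∀ k, ∀ y ∈ C k, sampleLaw f n {a | ∀ i, a i ∉ Metric.closedBall y r ∩ S k} ≤
      ENNReal.ofReal (Real.exp (-(n * (p * r ^ d)))) := fun k y hy =>
    hf.sampleLaw_forall_notMem_le n
      (Metric.isClosed_closedBall.measurableSet.inter (hf.measurableSet k))
      (h k y (hCS k hy) r hr hrr)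
  calc sampleLaw f n {a | ¬ IsDenseSample S a (2 * r)}
      ≤ ∑ k, ∑ y ∈ C k, sampleLaw f n {a | ∀ i, a i ∉ Metric.closedBall y r ∩ S k} :=
        (measure_mono hsub).trans <| (measure_iUnion_fintype_le _ _).trans <|
          Finset.sum_le_sum fun k _ => measure_biUnion_finset_le _ _
    _ ≤ ∑ _k : Fin K, ENNReal.ofReal ((p * (r / 3) ^ d)⁻¹ * Real.exp (-(n * (p * r ^ d)))) :=
        Finset.sum_le_sum fun k _ => by
          refine (Finset.sum_le_card_nsmul _ _ _ (hmiss k)).trans ?_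
          rw [nsmul_eq_mul, ← ENNReal.ofReal_natCast, ← ENNReal.ofReal_mul (Nat.cast_nonneg _)]
          refine ENNReal.ofReal_le_ofReal ?_
          gcongr
          exact (Nat.cast_le.2 (hcard k)).trans (Nat.floor_le (by positivity))
    _ = _ := by
        rw [Finset.sum_const, Finset.card_univ, Fintype.card_fin, nsmul_eq_mul,
          ENNReal.ofReal_mul (Nat.cast_nonneg K), ENNReal.ofReal_natCast]

/-- Hoeffding's inequality: an interval of length `1` gives variance proxy `1 / 4` per summand,
hence the exponent `(n * δ) ^ 2 / (2 * (n / 4))`. -/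
theorem sampleLaw_le_of_mem_Icc (hf : IsAdmissible f S ell) {n : ℕ} (hn : 0 < n)
    {g : EuclideanSpace ℝ (Fin d) → ℝ} (hg : Measurable g) {c : ℝ}
    (hgc : ∀ x, g x ∈ Set.Icc c (c + 1)) {δ : ℝ} (hδ : 0 ≤ δ) :
    sampleLaw f n {a | n * δ ≤ ∑ i, (g (a i) - ∫ x, g x ∂law f)} ≤
      ENNReal.ofReal (Real.exp (-(2 * δ ^ 2 * n))) := by
  have := hf.isProbabilityMeasure_law
  have : IsProbabilityMeasure (sampleLaw f n) := by rw [sampleLaw]; infer_instance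
  have hind : ProbabilityTheory.iIndepFun
      (fun (i : Fin n) (a : Fin n → EuclideanSpace ℝ (Fin d)) => g (a i) - ∫ x, g x ∂law f)
      (sampleLaw f n) :=
    ProbabilityTheory.iIndepFun_pi (X := fun _ x => g x - ∫ x, g x ∂law f)
      fun _ => (hg.sub_const _).aemeasurable
  have hint : ∀ i : Fin n, ∫ a, g (a i) ∂sampleLaw f n = ∫ x, g x ∂law f := fun i => by
    have hmp := measurePreserving_eval (fun _ : Fin n => law f) i
    conv_rhs => rw [← hmp.map_eq]
    exact (integral_map hmp.measurable.aemeasurable hg.aestronglyMeasurable).symm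
  have hsub : ∀ i ∈ (Finset.univ : Finset (Fin n)), ProbabilityTheory.HasSubgaussianMGF
      (fun a : Fin n → EuclideanSpace ℝ (Fin d) => g (a i) - ∫ x, g x ∂law f)
      ((‖(c + 1) - c‖₊ / 2) ^ 2) (sampleLaw f n) := fun i _ => by
    rw [← hint i]
    exact ProbabilityTheory.hasSubgaussianMGF_of_mem_Icc
      (hg.comp (measurable_pi_apply i)).aemeasurable (Filter.Eventually.of_forall fun a => hgc _)
  have hmain := ProbabilityTheory.HasSubgaussianMGF.measure_sum_ge_le_of_iIndepFun hind hsub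
    (show 0 ≤ n * δ by positivity)
  rw [← ofReal_measureReal]
  refine ENNReal.ofReal_le_ofReal (hmain.trans (Real.exp_le_exp.2 (le_of_eq ?_)))
  have hn' : (0 : ℝ) < n := by exact_mod_cast hn
  simp
  field_simp

theorem sampleLaw_abs_freq_sub_gt_le (hf : IsAdmissible f S ell) {n : ℕ} (hn : 0 < n)
    {A : Set (EuclideanSpace ℝ (Fin d))} (hA : MeasurableSet A) {δ : ℝ} (hδ : 0 ≤ δ) :
    sampleLaw f n {a | δ < |(∑ i, A.indicator (fun _ => (1 : ℝ)) (a i)) / n - (law f).real A|} ≤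
      ENNReal.ofReal (2 * Real.exp (-(2 * δ ^ 2 * n))) := by
  have := hf.isProbabilityMeasure_law
  have hn' : (0 : ℝ) < n := by exact_mod_cast hn
  have hm : Measurable (A.indicator fun _ => (1 : ℝ)) := measurable_const.indicator hA
  have hint : ∫ x, A.indicator (fun _ => (1 : ℝ)) x ∂law f = (law f).real A := by
    rw [integral_indicator_const _ hA]; simp
  have h01 : ∀ x, A.indicator (fun _ => (1 : ℝ)) x ∈ Set.Icc (0 : ℝ) 1 := fun x => by
    by_cases hx : x ∈ A <;> simp [hx]
  have h1 := hf.sampleLaw_le_of_mem_Icc hn hm (c := 0) (by simpa using h01) hδ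
  have h2 := hf.sampleLaw_le_of_mem_Icc hn hm.neg (c := -1)
    (fun x => by have := h01 x; constructor <;> simp <;> linarith [this.1, this.2]) hδ
  simp only [Pi.neg_apply, integral_neg] at h2
  rw [hint] at h1 h2
  rw [two_mul, ENNReal.ofReal_add (Real.exp_pos _).le (Real.exp_pos _).le]
  refine (measure_mono ?_).trans ((measure_union_le _ _).trans (add_le_add h1 h2))
  intro a ha
  rw [Set.mem_ofPred_eq, lt_abs] at ha
  simp only [Set.mem_union, Set.mem_ofPred_eq, Finset.sum_sub_distrib, Finset.sum_neg_distrib,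
    Finset.sum_const, Finset.card_univ, Fintype.card_fin, nsmul_eq_mul]
  set s := ∑ i, A.indicator (fun _ => (1 : ℝ)) (a i)
  have hs : n * (s / n) = s := by field_simp
  rcases ha with ha | ha
  · left
    nlinarith
  · right
    nlinarith

end IsAdmissible

end Leapfrog

/-! ### Rates in `n` and the choice of constants -/

namespace Leapfrog

/-- A sequence of probabilities that eventually decays like a stretched exponential is bounded by
a stretched exponential throughout. -/
theorem exists_forall_le_stretched_exp {C c b : ℝ} (hC : 0 < C) (hc : 0 < c) (hb : 0 < b) {N : ℕ}
    {P : (n : ℕ) → [NeZero n] → ENNReal} (hP : ∀ (n : ℕ) [NeZero n], P n ≤ 1)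
    (h : ∀ (n : ℕ) [NeZero n], N ≤ n → P n ≤ ENNReal.ofReal (C * Real.exp (-c * (n : ℝ) ^ b))) :
    ∃ c₁ c₂ c₃ : ℝ, 0 < c₁ ∧ 0 < c₂ ∧ 0 < c₃ ∧ ∀ (n : ℕ) [NeZero n],
      P n ≤ ENNReal.ofReal (c₁ * Real.exp (-c₂ * (n : ℝ) ^ c₃)) := by
  -- The second entry of the maximum makes the bound at least `1` for all `n < N`.
  refine ⟨max C (Real.exp (c * (N : ℝ) ^ b)), c, b, by positivity, hc, hb, fun n _ => ?_⟩
  rcases le_or_gt N n with hn | hn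
  · refine (h n hn).trans (ENNReal.ofReal_le_ofReal ?_)
    gcongr
    exact le_max_left _ _
  · refine (hP n).trans ?_
    rw [← ENNReal.ofReal_one]
    refine ENNReal.ofReal_le_ofReal ?_
    have h1 : (n : ℝ) ^ b ≤ (N : ℝ) ^ b :=
      Real.rpow_le_rpow (Nat.cast_nonneg _) (by exact_mod_cast hn.le) hb.le
    have h2 : Real.exp (c * (N : ℝ) ^ b) * Real.exp (-c * (n : ℝ) ^ b) ≤
        max C (Real.exp (c * (N : ℝ) ^ b)) * Real.exp (-c * (n : ℝ) ^ b) := by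
      gcongr
      exact le_max_right _ _
    refine le_trans ?_ h2
    rw [← Real.exp_add, Real.one_le_exp_iff]
    nlinarith

theorem tendsto_natCast_rpow_neg {γ : ℝ} (hγ : 0 < γ) :
    Filter.Tendsto (fun n : ℕ => (n : ℝ) ^ (-γ)) Filter.atTop (nhds 0) :=
  (tendsto_rpow_neg_atTop hγ).comp tendsto_natCast_atTop_atTop

theorem eventually_rpow_mul_exp_le {s c b : ℝ} (hc : 0 < c) (hb : 0 < b) :
    ∀ᶠ n : ℕ in Filter.atTop,
      (n : ℝ) ^ s * Real.exp (-(c * (n : ℝ) ^ b)) ≤ Real.exp (-(c / 2 * (n : ℝ) ^ b)) := by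
  have h1 : Filter.Tendsto (fun n : ℕ => (n : ℝ) ^ b) Filter.atTop Filter.atTop :=
    (tendsto_rpow_atTop hb).comp tendsto_natCast_atTop_atTop
  have h2 := (tendsto_rpow_mul_exp_neg_mul_atTop_nhds_zero (s / b) (c / 2) (half_pos hc)).comp h1
  filter_upwards [h2.eventually_le_const zero_lt_one] with n hn
  simp only [Function.comp_apply] at hn
  rw [← Real.rpow_mul (Nat.cast_nonneg n), mul_div_cancel₀ _ hb.ne'] at hn
  have h3 : Real.exp (-(c * (n : ℝ) ^ b)) =
      Real.exp (-(c / 2) * (n : ℝ) ^ b) * Real.exp (-(c / 2 * (n : ℝ) ^ b)) := by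
    rw [← Real.exp_add]; ring_nf
  rw [h3, ← mul_assoc]
  exact mul_le_of_le_one_left (Real.exp_pos _).le hn

namespace IsAdmissible

variable {d K : ℕ} {f : EuclideanSpace ℝ (Fin d) → ℝ}
  {S : Fin K → Set (EuclideanSpace ℝ (Fin d))} {ell : ℝ}

/-- With `r = n ^ (-γ) / 8`, the expected number of hits `n * r ^ d` is of order `n ^ (1 - γ * d) =
n ^ (η * d)`. The net has size of order `n ^ (γ * d)`, which is absorbed by halving the exponential
rate. -/
theorem exists_eventually_not_isDenseSample_le (hf : IsAdmissible f S ell) (hd : 0 < d) {η : ℝ}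
    (hη : 0 < η) (hηd : η < 1 / (d : ℝ)) :
    ∃ C c : ℝ, 0 < C ∧ 0 < c ∧ ∀ᶠ n : ℕ in Filter.atTop,
      sampleLaw f n {a | ¬ IsDenseSample S a ((n : ℝ) ^ (-(1 / (d : ℝ) - η)) / 4)} ≤
        ENNReal.ofReal (C * Real.exp (-(c * (n : ℝ) ^ (η * d)))) := by
  obtain ⟨r₀, p, hr₀, hp, h⟩ := hf.exists_sampleLaw_not_isDenseSample_le
  have hd' : (0 : ℝ) < d := by exact_mod_cast hd
  set γ := 1 / (d : ℝ) - η with hγdef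
  have hγ : 0 < γ := sub_pos.2 hηd
  have hc : 0 < p / 8 ^ d := by positivity
  refine ⟨(K + 1) * (24 ^ d / p), p / 8 ^ d / 2, by positivity, by positivity, ?_⟩
  filter_upwards [eventually_rpow_mul_exp_le (s := γ * d) hc (mul_pos hη hd'),
    (tendsto_natCast_rpow_neg hγ).eventually_le_const (show 0 < 8 * r₀ by positivity),
    Filter.eventually_gt_atTop 0] with n hexp hr hn
  have hn' : (0 : ℝ) < n := by exact_mod_cast hn
  have hpow : ((n : ℝ) ^ (-γ)) ^ d = ((n : ℝ) ^ (γ * d))⁻¹ := by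
    rw [← Real.rpow_natCast, ← Real.rpow_mul hn'.le, neg_mul, Real.rpow_neg hn'.le]
  have hnpow : n * ((n : ℝ) ^ (γ * d))⁻¹ = (n : ℝ) ^ (η * d) := by
    rw [← Real.rpow_neg hn'.le]
    nth_rewrite 1 [← Real.rpow_one (n : ℝ)]
    rw [← Real.rpow_add hn']
    congr 1
    rw [hγdef]
    field_simp
    ring
  have h1 := h n ((n : ℝ) ^ (-γ) / 8) (by positivity) (by linarith)
  rw [show 2 * ((n : ℝ) ^ (-γ) / 8) = (n : ℝ) ^ (-γ) / 4 by ring] at h1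
  refine h1.trans (ENNReal.ofReal_le_ofReal ?_)
  have e1 : (p * ((n : ℝ) ^ (-γ) / 8 / 3) ^ d)⁻¹ = 24 ^ d / p * (n : ℝ) ^ (γ * d) := by
    rw [div_div, div_pow, hpow]
    norm_num
    field_simp
  have e2 : n * (p * ((n : ℝ) ^ (-γ) / 8) ^ d) = p / 8 ^ d * (n : ℝ) ^ (η * d) := by
    rw [← hnpow, div_pow, hpow]
    ring
  rw [e1, e2, mul_assoc (24 ^ d / p), ← mul_assoc (K : ℝ)]
  gcongr
  linarith

/-- The base cluster depends on the sample, so the thresholds are minimised over the finitely many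
clusters. -/
theorem exists_embed_bound (hf : IsAdmissible f S ell) (hd : 0 < d) :
    ∃ δ > 0, ∃ ε₀ > 0, ∀ (n : ℕ) [NeZero n] (a : Fin n → EuclideanSpace ℝ (Fin d)) (ε : ℝ),
      (∀ i, a i ∈ ⋃ k, S k) → 0 < ε → ε ≤ ε₀ → IsDenseSample S a ε →
      (∀ k, |(∑ i, (S k).indicator (fun _ => (1 : ℝ)) (a i)) / n - (law f).real (S k)| ≤ δ) →
      ∃ o, a 0 ∈ S o ∧ ∀ (Q : Matrix (Fin n) (Fin n) ℝ) (ev : Fin n → ℝ),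
        IsEigendecomposition (gram 0 (sqLF a)) Q ev →
        ∀ (k : Fin K) (i i' : Fin n), a i ∈ S k → a i' ∈ S k →
        ∀ σ, σ = sigma f S o (limitSqLF S) ∨ (∃ rep : Fin K → Fin n, (∀ m, a (rep m) ∈ S m) ∧
            σ = sigma f S o (repSqLF a rep)) →
          ‖embed Q ev (embDim S o) i - embed Q ev (embDim S o) i'‖ ≤
            6 * cg S ell * √(embDim S o) / √σ * (4 * ε) := by
  choose δ hδ ε₀ hε₀ h using fun o => hf.exists_embed_bound_of_base hd o
  obtain ⟨δ', hδ', hδle⟩ := exists_pos_forall_le hδ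
  obtain ⟨ε', hε', hεle⟩ := exists_pos_forall_le hε₀
  refine ⟨δ', hδ', ε', hε', fun n _ a ε ha hε hεl hdense hfreq => ?_⟩
  choose κ hκ using fun i => Set.mem_iUnion.1 (ha i)
  refine ⟨κ 0, hκ 0, fun Q ev hQ k i i' hi hi' σ hσ => h (κ 0) n a κ ε hκ rfl hε
    (hεl.trans (hεle _)) hdense (fun k => ?_) Q ev hQ i i'
    ((hf.eq_of_mem (hκ i) hi).trans (hf.eq_of_mem (hκ i') hi').symm) σ hσ⟩
  have hcard : (fiberCard κ k : ℝ) = ∑ i, (S k).indicator (fun _ => (1 : ℝ)) (a i) := by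
    rw [fiberCard, Finset.card_filter, Nat.cast_sum]
    refine Finset.sum_congr rfl fun i _ => ?_
    by_cases hik : κ i = k
    · simp [hik, show a i ∈ S k from hik ▸ hκ i]
    · simp [hik, show a i ∉ S k from fun hi => hik (hf.eq_of_mem (hκ i) hi)]
  rw [hcard]
  exact (hfreq k).trans (hδle _)

end IsAdmissible

end Leapfrog

end

theorem theorem4 {d K : ℕ} (hd : 0 < d)
    (f : EuclideanSpace ℝ (Fin d) → ℝ) (S : Fin K → Set (EuclideanSpace ℝ (Fin d))) (ell : ℝ)
    (hf : Leapfrog.IsAdmissible f S ell) (η : ℝ) (hη : 0 < η) (hηd : η < 1 / (d : ℝ)) :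
    (∃ c₁ c₂ c₃ : ℝ, 0 < c₁ ∧ 0 < c₂ ∧ 0 < c₃ ∧ ∀ (n : ℕ) [NeZero n],
      Leapfrog.sampleLaw f n {a | ¬ ∃ o : Fin K, a 0 ∈ S o ∧
        ∀ (Q : Matrix (Fin n) (Fin n) ℝ) (ev : Fin n → ℝ),
          Leapfrog.IsEigendecomposition (Leapfrog.gram 0 (Leapfrog.sqLF a)) Q ev →
          ∀ (k : Fin K) (i i' : Fin n), a i ∈ S k → a i' ∈ S k →
            ‖Leapfrog.embed Q ev (Leapfrog.embDim S o) i -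
                Leapfrog.embed Q ev (Leapfrog.embDim S o) i'‖ ≤
              Leapfrog.bound S ell η (Leapfrog.embDim S o)
                (Leapfrog.sigma f S o (Leapfrog.limitSqLF S)) n ∧
            ∀ rep : Fin K → Fin n, (∀ m, a (rep m) ∈ S m) →
              ‖Leapfrog.embed Q ev (Leapfrog.embDim S o) i -
                  Leapfrog.embed Q ev (Leapfrog.embDim S o) i'‖ ≤
                Leapfrog.bound S ell η (Leapfrog.embDim S o)
                  (Leapfrog.sigma f S o (Leapfrog.repSqLF a rep)) n} ≤
        ENNReal.ofReal (c₁ * Real.exp (-c₂ * (n : ℝ) ^ c₃))) ∧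
    ∀ o : Fin K, Filter.Tendsto
      (fun n : ℕ => Leapfrog.bound S ell η (Leapfrog.embDim S o)
        (Leapfrog.sigma f S o (Leapfrog.limitSqLF S)) n) Filter.atTop (nhds 0) := by
  have hγ : 0 < 1 / (d : ℝ) - η := sub_pos.2 hηd
  have hd' : (0 : ℝ) < d := by exact_mod_cast hd
  refine ⟨?_, fun o => ?_⟩
  swap
  · simpa [Leapfrog.bound] using (Leapfrog.tendsto_natCast_rpow_neg hγ).const_mul
      (6 * Leapfrog.cg S ell * √(Leapfrog.embDim S o) /
        √(Leapfrog.sigma f S o (Leapfrog.limitSqLF S)))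
  have := hf.isProbabilityMeasure_law
  obtain ⟨δ, hδ, ε₀, hε₀, hbd⟩ := hf.exists_embed_bound hd
  obtain ⟨C, c, hC, hc, hdense⟩ := hf.exists_eventually_not_isDenseSample_le hd hη hηd
  obtain ⟨N, hN⟩ := Filter.eventually_atTop.1 (hdense.and
    ((Leapfrog.tendsto_natCast_rpow_neg hγ).eventually_le_const
      (show 0 < 4 * ε₀ by positivity)))
  have hc2 : 0 < min c (2 * δ ^ 2) := by positivity
  -- `C` accounts for density and `2` per cluster for the two-sided frequency bounds.
  refine Leapfrog.exists_forall_le_stretched_exp (C := C + K * 2) (N := N) (by positivity) hc2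
    (mul_pos hη hd') (fun n _ => ?_) fun n _ hn => ?_
  · have : IsProbabilityMeasure (Leapfrog.sampleLaw f n) := by
      rw [Leapfrog.sampleLaw]; infer_instance
    exact prob_le_one
  obtain ⟨hdn, hεn⟩ := hN n hn
  have hn0 : 0 < n := Nat.pos_of_ne_zero (NeZero.ne n)
  have hn' : (0 : ℝ) < n := by exact_mod_cast hn0
  set ε := (n : ℝ) ^ (-(1 / (d : ℝ) - η)) / 4 with hε
  have hε0 : 0 < ε := by positivity
  set u := (n : ℝ) ^ (η * d)
  -- The frequencies fail with probability of order `exp (-2 * δ ^ 2 * n)`; since `η * d < 1`, this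
  -- is weakened to the exponent `n ^ (η * d)` of the density estimate.
  have hu : u ≤ n := by
    calc u ≤ (n : ℝ) ^ (1 : ℝ) := Real.rpow_le_rpow_of_exponent_le (by exact_mod_cast hn0)
          ((lt_div_iff₀ hd').1 hηd).le
      _ = n := Real.rpow_one _
  have hu0 : 0 ≤ u := by positivity
  have hsub : {a | ¬ ∃ o : Fin K, a 0 ∈ S o ∧
        ∀ (Q : Matrix (Fin n) (Fin n) ℝ) (ev : Fin n → ℝ),
          Leapfrog.IsEigendecomposition (Leapfrog.gram 0 (Leapfrog.sqLF a)) Q ev →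
          ∀ (k : Fin K) (i i' : Fin n), a i ∈ S k → a i' ∈ S k →
            ‖Leapfrog.embed Q ev (Leapfrog.embDim S o) i -
                Leapfrog.embed Q ev (Leapfrog.embDim S o) i'‖ ≤
              Leapfrog.bound S ell η (Leapfrog.embDim S o)
                (Leapfrog.sigma f S o (Leapfrog.limitSqLF S)) n ∧
            ∀ rep : Fin K → Fin n, (∀ m, a (rep m) ∈ S m) →
              ‖Leapfrog.embed Q ev (Leapfrog.embDim S o) i -
                  Leapfrog.embed Q ev (Leapfrog.embDim S o) i'‖ ≤
                Leapfrog.bound S ell η (Leapfrog.embDim S o)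
                  (Leapfrog.sigma f S o (Leapfrog.repSqLF a rep)) n} ⊆
      {a | ∃ i, a i ∉ ⋃ k, S k} ∪ ({a | ¬ Leapfrog.IsDenseSample S a ε} ∪
        ⋃ k, {a | δ < |(∑ i, (S k).indicator (fun _ => (1 : ℝ)) (a i)) / n -
          (Leapfrog.law f).real (S k)|}) := fun a ha => by
    by_contra hcon
    simp only [Set.mem_union, Set.mem_iUnion, Set.mem_ofPred_eq, not_or, not_exists, not_not,
      not_lt] at hcon
    obtain ⟨h1, h2, h3⟩ := hcon
    obtain ⟨o, ho, hall⟩ := hbd n a ε (by simpa using h1) hε0 (by rw [hε]; linarith) h2 h3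
    have hεeq : 4 * ε = (n : ℝ) ^ (-(1 / (d : ℝ) - η)) := by rw [hε]; ring
    rw [hεeq] at hall
    exact ha ⟨o, ho, fun Q ev hQ k i i' hi hi' =>
      ⟨hall Q ev hQ k i i' hi hi' _ (Or.inl rfl), fun rep hrep =>
        hall Q ev hQ k i i' hi hi' _ (Or.inr ⟨rep, hrep, rfl⟩)⟩⟩
  -- Monotonicity and subadditivity hold for arbitrary sets, so the bad event need not be shown
  -- measurable.
  refine (measure_mono hsub).trans ((measure_union_le _ _).trans ?_)
  rw [hf.sampleLaw_exists_notMem_iUnion, zero_add, add_mul, ENNReal.ofReal_add (by positivity)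
    (by positivity)]
  refine (measure_union_le _ _).trans (add_le_add (hdn.trans (ENNReal.ofReal_le_ofReal ?_)) ?_)
  · gcongr
    rw [neg_mul, neg_le_neg_iff]
    gcongr
    exact min_le_left _ _
  · refine (measure_iUnion_fintype_le _ _).trans ((Finset.sum_le_card_nsmul _ _ _ fun k _ =>
      hf.sampleLaw_abs_freq_sub_gt_le hn0 (hf.measurableSet k) hδ.le).trans ?_)
    rw [Finset.card_univ, Fintype.card_fin, nsmul_eq_mul, ← ENNReal.ofReal_natCast,
      ← ENNReal.ofReal_mul (Nat.cast_nonneg _), ← mul_assoc (K : ℝ)]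
    refine ENNReal.ofReal_le_ofReal ?_
    gcongr
    rw [neg_mul, neg_le_neg_iff]
    exact mul_le_mul (min_le_right _ _) hu hu0 (by positivity)
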